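/- **Data words.** A data $\omega$-word $\sigma$ over a finite alphabet $\Sigma$ is an $\omega$-word $\mathrm{str}(\sigma)=\sigma(0)\sigma(1)\cdots$ over $\Sigma$ together with an equivalence relation $\sim$ on $\mathbb N$; $[i]_\sim$ is the class of $i$. **Safety 1ARA$_1$.** A safety one-way alternating automaton with one register is $\mathcal A=\langle\Sigma,Q,q_I,\delta\rangle$ with $\Sigma,Q$ finite, $q_I\in Q$, and $\delta:Q\times\Sigma\times\{\uparrow,\not\uparrow\}\to\mathcal B^+_\downarrow(Q)$, where $\mathcal B^+_\downarrow(Q)$ is the set of positive Boolean formulae $\varphi::=q\mid{\downarrow}q\mid\top\mid\bot\mid\varphi\wedge\varphi\mid\varphi\vee\varphi$ ($q\in Q$). A pair $P,P_\downarrow\subseteq Q$ satisfies $q$ iff $q\in P$, satisfies ${\downarrow}q$ iff $q\in P_\downarrow$, and the other cases are standard. Configurations for $\sigma$ are elements of $Q\times(\mathbb N/{\sim})$. For finite sets $F,F'$ of configurations, $F\xrightarrow{\sigma,i}F'$ iff for each $\langle q,D\rangle\in F$ there are $P^{q,D},P^{q,D}_\downarrow\subseteq Q$ satisfying $\delta(q,\sigma(i),\uparrow)$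 if $D=[i]_\sim$ and $\delta(q,\sigma(i),\not\uparrow)$ if $D\ne[i]_\sim$, such that $$F'=\{\langle q',D\rangle:\langle q,D\rangle\in F,\ q'\in P^{q,D}\}\cup\{\langle q',[i]_\sim\rangle:\langle q,D\rangle\in F,\ q'\in P^{q,D}_\downarrow\}.$$ $\mathrm L(\mathcal A)$ is the set of all data $\omega$-words $\sigma$ for which there is an infinite sequence $F_0\xrightarrow{\sigma,0}F_1\xrightarrow{\sigma,1}\cdots$ with $F_0=\{\langle q_I,[0]_\sim\rangle\}$. **Safety IPCANT.** A safety powerset counter automaton with nondeterministic transfers and incrementing errors is $\mathcal C=\langle\Sigma,Q,q_I,X,C,\delta\rangle$ with $\Sigma,Q,X$ finite, $q_I\in Q$, a set $C\subseteq\mathcal P(X)\setminus\{\emptyset\}$ of counters over the basis $X$, and $\delta\subseteq Q\times(\Sigma\uplus\{\varepsilon\})\times L(C)\times Q$ containing no cycle of $\varepsilon$ transitions. Here $L(C)$ consists of the instructions $\langle\mathtt{inc},c\rangle$ and $\langle\mathtt{dec},c\rangle$ for $c\in C$, and $\langle\mathtt{transf},f\rangle$ for $f:C\to\mathcal P(C)$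 that are distributive: whenever $c\in C$, $c\subseteq\bigcup_{i=1}^kc_i$ and $c_i'\in f(c_i)$ for all $i$, there is $c'\in f(c)$ with $c'\subseteq\bigcup_{i=1}^kc_i'$. Configurations are pairs $\langle q,v\rangle$ with $q\in Q$ and $v:C\to\mathbb N$. Instructions $\mathtt{inc}$, $\mathtt{dec}$ have the standard meaning ($\mathtt{dec}$ requires $v(c)>0$), and $\langle\mathtt{transf},f\rangle$ leads from $v$ to $v'$ iff there are $K^c_{c'}\in\mathbb N$ ($c\in C$, $c'\in f(c)$) with $v(c)=\sum_{c'\in f(c)}K^c_{c'}$ for all $c$ and $v'(c')=\sum_{c:\,f(c)\ni c'}K^c_{c'}$ for all $c'$. There is a transition $\langle q,v\rangle\xrightarrow{w,l}\langle q',v'\rangle$ iff $\langle q,w,l,q'\rangle\in\delta$ and, for some $u\ge v$ and $u'\le v'$ (pointwise), $l$ leads from $u$ to $u'$. $\mathrm L(\mathcal C)$ is the set of all $\omega$-words $w=w_0w_1\cdots$ over $\Sigma$ for which there is an infinite run $\langle q_0,v_0\rangle\xrightarrow{w_0,l_0}\langle q_1,v_1\rangle\xrightarrow{w_1,l_1}\cdots$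 with $\langle q_0,v_0\rangle=\langle q_I,\mathbf 0\rangle$. **Theorem.** There are a deterministic Turing machine $T$ with a write-only output (whose length does not count towards the space used), a polynomial $p$ and a constant $k$ such that, for every safety 1ARA$_1$ $\mathcal A=\langle\Sigma,Q,q_I,\delta\rangle$, given as a string of length $m$ that lists its transition table, $T$ halts using space at most $p(m)$, and outputs an explicit description (lists of the states, counters and transitions) of a safety IPCANT $\mathcal C_{\mathcal A}$ such that: 1. $\mathcal C_{\mathcal A}$ has the same alphabet $\Sigma$ as $\mathcal A$; 2. the basis of $\mathcal C_{\mathcal A}$ has at most $k\cdot|Q|$ elements; 3. $\mathrm L(\mathcal C_{\mathcal A})=\{\mathrm{str}(\sigma):\sigma\in\mathrm L(\mathcal A)\}$. In particular, $\mathrm L(\mathcal C_{\mathcal A})\ne\emptyset$ if and only if $\mathrm L(\mathcal A)\ne\emptyset$. -/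

import Mathlib

/-! ### Data words -/

/-- A data `ω`-word over `S`: an `ω`-word together with an equivalence relation on positions. -/
structure DataWord (S : Type) where
  str : ℕ → S
  rel : Setoid ℕ

namespace DataWord

/-- The classes of positions of a data word (its "data"). -/
abbrev Datum {S : Type} (σ : DataWord S) : Type := Quotient σ.rel

/-- The class `[i]` of position `i`. -/
abbrev cls {S : Type} (σ : DataWord S) (i : ℕ) : σ.Datum := Quotient.mk σ.rel i

end DataWord

/-! ### Safety one-way alternating automata with one register -/

/-- Positive Boolean formulae over `Q ∪ ↓Q`. -/
inductive PosBool (Q : Type) : Type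
  | state (q : Q)
  | down (q : Q)
  | top
  | bot
  | and (φ ψ : PosBool Q)
  | or (φ ψ : PosBool Q)

namespace PosBool

/-- `φ.Sat P P'` is satisfaction of `φ` by the pair `P, P'`, where `P'` interprets `↓Q`. -/
def Sat {Q : Type} (P P' : Set Q) : PosBool Q → Prop
  | state q => q ∈ P
  | down q => q ∈ P'
  | top => True
  | bot => False
  | and φ ψ => Sat P P' φ ∧ Sat P P' ψ
  | or φ ψ => Sat P P' φ ∨ Sat P P' ψ

end PosBool

/-- A safety 1ARA₁ over the alphabet `S`.  The last argument of `δ` is `true` if the register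
value is the class of the current position, and `false` otherwise. -/
structure SafetyARA (S : Type) where
  Q : Type
  [fintypeQ : Fintype Q]
  init : Q
  δ : Q → S → Bool → PosBool Q

attribute [instance] SafetyARA.fintypeQ

namespace SafetyARA

variable {S : Type}

/-- Configurations: a state and a register value. -/
abbrev Config (A : SafetyARA S) (σ : DataWord S) : Type := A.Q × σ.Datum

/-- The transition relation between finite sets of configurations at position `i` of `σ`. -/
def Step (A : SafetyARA S) (σ : DataWord S) (i : ℕ) (F F' : Finset (A.Config σ)) : Prop :=
  ∃ P P' : A.Config σ → Set A.Q,
    (∀ q D, (q, D) ∈ F →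
      (D = σ.cls i → (A.δ q (σ.str i) true).Sat (P (q, D)) (P' (q, D))) ∧
      (D ≠ σ.cls i → (A.δ q (σ.str i) false).Sat (P (q, D)) (P' (q, D)))) ∧
    (F' : Set (A.Config σ)) =
      {x | ∃ q D, (q, D) ∈ F ∧ ∃ q' ∈ P (q, D), x = (q', D)} ∪
      {x | ∃ q D, (q, D) ∈ F ∧ ∃ q' ∈ P' (q, D), x = (q', σ.cls i)}

/-- `A` accepts `σ` iff it has an infinite run on `σ` from the initial configuration. -/
def Accepts (A : SafetyARA S) (σ : DataWord S) : Prop :=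
  ∃ F : ℕ → Finset (A.Config σ),
    F 0 = {(A.init, σ.cls 0)} ∧ ∀ i, A.Step σ i (F i) (F (i + 1))

/-- The language of `A`. -/
def language (A : SafetyARA S) : Set (DataWord S) := {σ | A.Accepts σ}

end SafetyARA

/-! ### Safety powerset counter automata with nondeterministic transfers and incrementing errors -/

/-- Counter instructions over a type `C` of counters. -/
inductive CounterInstr (C : Type) : Type
  | inc (c : C)
  | dec (c : C)
  | transf (f : C → Finset C)

namespace CounterInstr

/-- `l.Performs v v'`: the valuation `v'` can be obtained from `v` by `l`, without errors. -/
def Performs {C : Type} [Fintype C] [DecidableEq C] :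
    CounterInstr C → (C → ℕ) → (C → ℕ) → Prop
  | inc c, v, v' => v' = Function.update v c (v c + 1)
  | dec c, v, v' => 0 < v c ∧ v' = Function.update v c (v c - 1)
  | transf f, v, v' => ∃ K : C → C → ℕ,
      (∀ c, v c = ∑ c' ∈ f c, K c c') ∧
      (∀ c', v' c' = ∑ c with c' ∈ f c, K c c')

end CounterInstr

/-- Distributivity of a mapping from counters to sets of counters, where the counters are the
members of a family `C` of subsets of `X`. -/
def IsDistributive {X : Type} {C : Finset (Finset X)} (f : C → Finset C) : Prop :=
  ∀ (c : C) (k : ℕ) (d d' : Fin k → C),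
    (∀ x ∈ c.1, ∃ i, x ∈ (d i).1) → (∀ i, d' i ∈ f (d i)) →
    ∃ c' ∈ f c, ∀ x ∈ c'.1, ∃ i, x ∈ (d' i).1

/-- A safety IPCANT over the alphabet `S`.  In transitions, the label `none` is `ε`. -/
structure SafetyIPCANT (S : Type) where
  Q : Type
  [fintypeQ : Fintype Q]
  init : Q
  /-- the basis -/
  X : Type
  [fintypeX : Fintype X]
  [decEqX : DecidableEq X]
  /-- the set of counters -/
  C : Finset (Finset X)
  nonempty_of_mem : ∀ c ∈ C, c.Nonempty
  δ : Set (Q × Option S × CounterInstr C × Q)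
  distributive : ∀ q w f q', (q, w, CounterInstr.transf f, q') ∈ δ → IsDistributive f
  /-- there is no cycle of `ε` transitions -/
  acyclic : ∀ q, ¬ Relation.TransGen (fun p p' => ∃ l, (p, none, l, p') ∈ δ) q q

attribute [instance] SafetyIPCANT.fintypeQ SafetyIPCANT.fintypeX SafetyIPCANT.decEqX

namespace SafetyIPCANT

variable {S : Type}

/-- Counter valuations. -/
abbrev Val (A : SafetyIPCANT S) : Type := A.C → ℕ

/-- Error-free transitions between configurations. -/
def StepExact (A : SafetyIPCANT S) (w : Option S) (l : CounterInstr A.C)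
    (x x' : A.Q × A.Val) : Prop :=
  (x.1, w, l, x'.1) ∈ A.δ ∧ l.Performs x.2 x'.2

/-- Transitions, which may contain incrementing errors. -/
def Step (A : SafetyIPCANT S) (w : Option S) (l : CounterInstr A.C)
    (x x' : A.Q × A.Val) : Prop :=
  ∃ u u' : A.Val, x.2 ≤ u ∧ A.StepExact w l (x.1, u) (x'.1, u') ∧ u' ≤ x'.2

/-- `SpellsWord lab w`: the concatenation of the labels `lab 0, lab 1, …`, in which `none` is the
empty word, is the `ω`-word `w`; `φ` enumerates the positions of the labels that are letters. -/
def SpellsWord (lab : ℕ → Option S) (w : ℕ → S) : Prop :=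
  ∃ φ : ℕ → ℕ, StrictMono φ ∧ (∀ n, lab (φ n) = some (w n)) ∧
    ∀ j, j ∉ Set.range φ → lab j = none

/-- `A` accepts `w` iff it has an infinite run over `w`, possibly with incrementing errors, from
the initial state with all counters zero. -/
def Accepts (A : SafetyIPCANT S) (w : ℕ → S) : Prop :=
  ∃ (x : ℕ → A.Q × A.Val) (lab : ℕ → Option S) (l : ℕ → CounterInstr A.C),
    x 0 = (A.init, 0) ∧ (∀ i, A.Step (lab i) (l i) (x i) (x (i + 1))) ∧ SpellsWord lab w

/-- The language of `A`. -/
def language (A : SafetyIPCANT S) : Set (ℕ → S) := {w | A.Accepts w}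

end SafetyIPCANT

/-! ### Representing automata by strings

Letters are numbered.  States of a register automaton are numbered as well, and numbers are
written in tally notation; since the transition function is written out as a table, that makes at
most a polynomial difference to the size.  States of a counter automaton, of which there may be
exponentially many, are named by arbitrary distinct bit strings. -/

/-- The symbols used in representations. -/
inductive Token : Type
  | zero | one | sep | lpar | rpar
  | st | down | top | bot | and | or
  | eps | letter | inc | dec | transf
  deriving DecidableEq

namespace Token

/-- Tally notation. -/
def tally (n : ℕ) : List Token := List.replicate n one ++ [sep]

/-- Bit strings. -/
def bits (l : List Bool) : List Token := l.map (fun b => if b then one else zero) ++ [sep]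

end Token

namespace PosBool

/-- Formulae in prefix notation. -/
def encode {Q : Type} (num : Q → ℕ) : PosBool Q → List Token
  | state q => Token.st :: Token.tally (num q)
  | down q => Token.down :: Token.tally (num q)
  | top => [Token.top]
  | bot => [Token.bot]
  | and φ ψ => Token.and :: (encode num φ ++ encode num ψ)
  | or φ ψ => Token.or :: (encode num φ ++ encode num ψ)

end PosBool

/-- The string representing `A` with respect to numberings of letters and states: the numbers of
letters and of states, the initial state, and the table of the transition function. -/
def SafetyARA.encode {S : Type} [Fintype S] (A : SafetyARA S)
    (eS : S ≃ Fin (Fintype.card S)) (eQ : A.Q ≃ Fin (Fintype.card A.Q)) : List Token :=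
  Token.tally (Fintype.card S) ++ Token.tally (Fintype.card A.Q) ++ Token.tally (eQ A.init) ++
    (List.finRange (Fintype.card A.Q)).flatMap fun q =>
      (List.finRange (Fintype.card S)).flatMap fun a =>
        [true, false].flatMap fun b =>
          (A.δ (eQ.symm q) (eS.symm a) b).encode fun p => (eQ p : ℕ)

/-- `IsListing s R w`: the string `w` is a parenthesized enumeration of all members of the set `s`
(in any order, repetitions allowed), each member `a` being represented by a string `u` with
`R a u`. -/
def IsListing {α : Type} (s : Set α) (R : α → List Token → Prop) (w : List Token) : Prop :=
  ∃ L : List (α × List Token),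
    (∀ a, a ∈ s ↔ ∃ p ∈ L, p.1 = a) ∧ (∀ p ∈ L, R p.1 p.2) ∧
    w = Token.lpar :: ((L.map Prod.snd).flatten ++ [Token.rpar])

namespace SafetyIPCANT

variable {S : Type}

/-- A subset of the basis as a bit vector, with respect to a numbering of the basis. -/
def encodeSubset (A : SafetyIPCANT S) (eX : A.X ≃ Fin (Fintype.card A.X)) (c : Finset A.X) :
    List Token :=
  Token.bits ((List.finRange (Fintype.card A.X)).map fun i => decide (eX.symm i ∈ c))

/-- The string `w` represents the instruction `l`.  The mapping of a transfer is represented by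
an enumeration of the pairs `(c, c')` with `c' ∈ f c`. -/
def InstrDescribedBy (A : SafetyIPCANT S) (eX : A.X ≃ Fin (Fintype.card A.X)) :
    CounterInstr A.C → List Token → Prop
  | .inc c, w => w = Token.inc :: A.encodeSubset eX c.1
  | .dec c, w => w = Token.dec :: A.encodeSubset eX c.1
  | .transf f, w => ∃ u, w = Token.transf :: u ∧
      IsListing {p : A.C × A.C | p.2 ∈ f p.1}
        (fun p z => z = A.encodeSubset eX p.1.1 ++ A.encodeSubset eX p.2.1) u

/-- Transition labels. -/
def encodeLabel [Fintype S] (eS : S ≃ Fin (Fintype.card S)) : Option S → List Token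
  | none => [Token.eps]
  | some a => Token.letter :: Token.tally (eS a)

/-- The string `w` represents the transition `t`. -/
def TransDescribedBy [Fintype S] (A : SafetyIPCANT S) (eS : S ≃ Fin (Fintype.card S))
    (eX : A.X ≃ Fin (Fintype.card A.X)) (name : A.Q → List Bool)
    (t : A.Q × Option S × CounterInstr A.C × A.Q) (w : List Token) : Prop :=
  ∃ u, A.InstrDescribedBy eX t.2.2.1 u ∧
    w = Token.bits (name t.1) ++ encodeLabel eS t.2.1 ++ u ++ Token.bits (name t.2.2.2)

/-- The string `w` represents `A` with respect to the numbering `eS` of letters: for some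
numbering of the basis and some naming of the states by distinct bit strings, `w` consists of the
number of letters, the set of states, the initial state, the size of the basis, the set of
counters, and the transition relation. -/
def DescribedBy [Fintype S] (A : SafetyIPCANT S) (eS : S ≃ Fin (Fintype.card S))
    (w : List Token) : Prop :=
  ∃ (eX : A.X ≃ Fin (Fintype.card A.X)) (name : A.Q → List Bool) (wQ wC wδ : List Token),
    Function.Injective name ∧
    IsListing Set.univ (fun q u => u = Token.bits (name q)) wQ ∧
    IsListing (A.C : Set (Finset A.X)) (fun c u => u = A.encodeSubset eX c) wC ∧
    IsListing A.δ (A.TransDescribedBy eS eX name) wδ ∧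
    w = Token.tally (Fintype.card S) ++ wQ ++ Token.bits (name A.init) ++
      Token.tally (Fintype.card A.X) ++ wC ++ wδ

end SafetyIPCANT

/-! ### Space-bounded computation with a write-only output -/

/-- The statement never inspects nor removes the contents of stack `k`. -/
def NeverReads {K : Type} {Γ : K → Type} {Λ σ : Type} (k : K) : Turing.TM2.Stmt Γ Λ σ → Prop
  | .push _ _ q => NeverReads k q
  | .peek j _ q => j ≠ k ∧ NeverReads k q
  | .pop j _ q => j ≠ k ∧ NeverReads k q
  | .load _ q => NeverReads k q
  | .branch _ q₁ q₂ => NeverReads k q₁ ∧ NeverReads k q₂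
  | .goto _ => True
  | .halt => True

/-- A deterministic Turing machine with finitely many stacks over finite alphabets, whose output
stack is write-only. -/
structure Transducer (I O : Type) extends Turing.TM2ComputableAux I O where
  finite_alphabet : ∀ k, Finite (tm.Γ k)
  input_ne_output : tm.k₀ ≠ tm.k₁
  write_only : ∀ l, NeverReads tm.k₁ (tm.m l)

namespace Transducer

variable {I O : Type}

/-- The configurations that occur in the computation on input `x`. -/
def Visits (T : Transducer I O) (x : List I)
    (c : Turing.TM2.Cfg T.tm.Γ T.tm.Λ T.tm.σ) : Prop :=
  Turing.TM2.Reaches T.tm.m (Turing.initList T.tm (x.map T.inputAlphabet.symm)) c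

/-- The space used by a configuration: the number of symbols on all the stacks except the
output. -/
def space (T : Transducer I O) (c : Turing.TM2.Cfg T.tm.Γ T.tm.Λ T.tm.σ) : ℕ :=
  letI := T.tm.kFin
  ∑ k with k ≠ T.tm.k₁, (c.stk k).length

/-- On input `x`, the machine halts having written `y` (in this order) to the output, and uses
space at most `b` throughout. -/
def OutputsInSpace (T : Transducer I O) (x : List I) (y : List O) (b : ℕ) : Prop :=
  (∃ c, T.Visits x c ∧ c.l = none ∧ ((c.stk T.tm.k₁).map T.outputAlphabet).reverse = y) ∧
  ∀ c, T.Visits x c → T.space c ≤ b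

end Transducer

/-!
For every set `d` of states of the register automaton there is a counter that counts the data, other
than the datum of the current position, which occur in the current configuration with exactly the
states in `d`. To read a letter, guess the set `e` of states that the current datum has afterwards,
and transfer every counter `d` to counters `d'` such that `d'`, together with `e` for the states
under `↓`, satisfies the formulae of the states in `d`. Since positive formulae are monotone, these
transfers are distributive. Then an increment of `e` returns the current datum to the others, and
a decrement takes out the datum of the next position, or none is taken out and that datum is fresh.

Conversely, a run of the counter automaton is followed by explicit data whose counts stay below the
counters, so incrementing errors are harmless. A decrement that no explicit datum accounts for is
imitated by a fresh datum. By the safety condition it suffices that the run goes on forever.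

The exponentially many sets of states are enumerated by binary counters of linear length. Formulae
are in prefix notation, so that a scan of the table from right to left evaluates all of them with
one stack. Space is bounded by a credit argument: each input symbol pays for a constant number of
others.
-/

/-! ### Labellings and transfers -/

section Labelling

variable {C ι : Type} [DecidableEq C] {B B' : Finset ι} {lab lab' : ι → C} {v v' w w' : C → ℕ}

/-- The counter valuation given by a labelling of the members of `B` with counters: each counter
has as value the number of members of `B` that it labels. -/
def labelCount (B : Finset ι) (lab : ι → C) (c : C) : ℕ := (B.filter fun D => lab D = c).card

theorem labelCount_empty : labelCount ∅ lab = 0 := rfl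

theorem labelCount_mono (h : B ⊆ B') (lab : ι → C) : labelCount B lab ≤ labelCount B' lab :=
  fun _ => Finset.card_le_card (Finset.filter_subset_filter _ h)

theorem labelCount_congr (h : ∀ D ∈ B, lab D = lab' D) : labelCount B lab = labelCount B lab' :=
  funext fun _ => congrArg Finset.card (Finset.filter_congr fun D hD => by rw [h D hD])

theorem labelCount_eq_zero {c : C} (h : ∀ D ∈ B, lab D ≠ c) : labelCount B lab c = 0 :=
  Finset.card_eq_zero.2 (Finset.filter_eq_empty_iff.2 fun _ hD => h _ hD)

theorem labelCount_insert [DecidableEq ι] {D : ι} (hD : D ∉ B) (lab : ι → C) :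
    labelCount (insert D B) lab =
      Function.update (labelCount B lab) (lab D) (labelCount B lab (lab D) + 1) := by
  refine Function.eq_update_iff.2 ⟨?_, fun c hc => ?_⟩ <;> unfold labelCount
  · rw [Finset.filter_insert, if_pos rfl, Finset.card_insert_of_notMem (by simp [hD])]
  · rw [Finset.filter_insert, if_neg hc.symm]

theorem sum_labelCount {s : Finset C} (h : ∀ D ∈ B, lab D ∈ s) :
    ∑ c ∈ s, labelCount B lab c = B.card :=
  (Finset.card_eq_sum_card_fiberwise h).symm

theorem labelCount_eq_sum_filter [Fintype C] {f : C → Finset C}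
    (h : ∀ D ∈ B, lab' D ∈ f (lab D)) (c' : C) :
    labelCount B lab' c' =
      ∑ c with c' ∈ f c, labelCount (B.filter fun D => lab D = c) lab' c' := by
  unfold labelCount
  rw [Finset.card_eq_sum_card_fiberwise (f := lab) (t := {c | c' ∈ f c})]
  · simp only [Finset.filter_comm]
  · intro D hD
    obtain ⟨hB, rfl⟩ := Finset.mem_filter.1 hD
    exact Finset.mem_filter.2 ⟨Finset.mem_univ _, h D hB⟩

theorem exists_labelling_of_card_le [Nonempty C] {s : Finset C} {k : C → ℕ}
    (h : B.card ≤ ∑ c ∈ s, k c) :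
    ∃ lab : ι → C, (∀ D ∈ B, lab D ∈ s) ∧ ∀ c ∈ s, labelCount B lab c ≤ k c := by
  classical
  induction B using Finset.induction with
  | empty => exact ⟨fun _ => Classical.arbitrary C, by simp, by simp [labelCount_empty]⟩
  | insert D B hD ih =>
    rw [Finset.card_insert_of_notMem hD] at h
    obtain ⟨lab, hlab, hk⟩ := ih (by omega)
    obtain ⟨c, hc, hlt⟩ : ∃ c ∈ s, labelCount B lab c < k c := by
      refine Finset.exists_lt_of_sum_lt ?_
      rw [sum_labelCount hlab]
      omega
    have hagree : ∀ E ∈ B, Function.update lab D c E = lab E := fun E hE =>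
      Function.update_of_ne (ne_of_mem_of_not_mem hE hD) ..
    refine ⟨Function.update lab D c, fun E hE => ?_, fun c' hc' => ?_⟩
    · rcases Finset.mem_insert.1 hE with rfl | hE
      · rwa [Function.update_self]
      · rw [hagree E hE]
        exact hlab E hE
    · rw [labelCount_insert hD, Function.update_self, labelCount_congr hagree]
      rcases eq_or_ne c' c with rfl | hne
      · rwa [Function.update_self]
      · rw [Function.update_of_ne hne]
        exact hk c' hc'

namespace CounterInstr

variable [Fintype C]

theorem performs_inc_labelCount [DecidableEq ι] {D : ι} (hD : D ∈ B) (lab : ι → C) :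
    (inc (lab D)).Performs (labelCount (B.erase D) lab) (labelCount B lab) := by
  conv => arg 3; rw [← Finset.insert_erase hD]
  exact labelCount_insert (Finset.notMem_erase D B) lab

theorem performs_dec_labelCount [DecidableEq ι] {D : ι} (hD : D ∈ B) (lab : ι → C) :
    (dec (lab D)).Performs (labelCount B lab) (labelCount (B.erase D) lab) := by
  have h : labelCount B lab = _ := performs_inc_labelCount hD lab
  refine ⟨by simp [h], ?_⟩
  simp [h]

theorem performs_transf_labelCount {f : C → Finset C} (h : ∀ D ∈ B, lab' D ∈ f (lab D)) :
    (transf f).Performs (labelCount B lab) (labelCount B lab') := by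
  refine ⟨fun c => labelCount (B.filter fun D => lab D = c) lab', fun c => ?_,
    labelCount_eq_sum_filter h⟩
  refine (sum_labelCount fun D hD => ?_).symm
  obtain ⟨hB, rfl⟩ := Finset.mem_filter.1 hD
  exact h D hB

theorem exists_labelling_of_performs_transf {f : C → Finset C} (hv : (transf f).Performs v v')
    (hle : labelCount B lab ≤ v) :
    ∃ lab' : ι → C, (∀ D ∈ B, lab' D ∈ f (lab D)) ∧ labelCount B lab' ≤ v' := by
  obtain ⟨K, hK, hK'⟩ := hv
  have hclass (c : C) : ∃ g : ι → C, (∀ D ∈ B.filter fun D => lab D = c, g D ∈ f c) ∧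
      ∀ c' ∈ f c, labelCount (B.filter fun D => lab D = c) g c' ≤ K c c' :=
    haveI : Nonempty C := ⟨c⟩
    exists_labelling_of_card_le ((hle c).trans_eq (hK c))
  choose g hg hgK using hclass
  have hmem : ∀ D ∈ B, g (lab D) D ∈ f (lab D) := fun D hD =>
    hg _ D (Finset.mem_filter.2 ⟨hD, rfl⟩)
  refine ⟨fun D => g (lab D) D, hmem, fun c' => ?_⟩
  rw [hK' c', labelCount_eq_sum_filter hmem]
  refine Finset.sum_le_sum fun c hc => ?_
  rw [labelCount_congr (lab' := g c) fun D hD => by rw [(Finset.mem_filter.1 hD).2]]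
  exact hgK c c' (Finset.mem_filter.1 hc).2

theorem Performs.inc_mono {c : C} (hv : (inc c).Performs v v') (hw : (inc c).Performs w w')
    (h : v ≤ w) : v' ≤ w' := by
  obtain rfl : v' = _ := hv
  obtain rfl : w' = _ := hw
  exact update_le_update_iff.2 ⟨Nat.succ_le_succ (h c), fun c' _ => h c'⟩

theorem Performs.dec_mono {c : C} (hv : (dec c).Performs v v') (hw : (dec c).Performs w w')
    (h : v ≤ w) : v' ≤ w' := by
  obtain ⟨-, rfl⟩ := hv
  obtain ⟨-, rfl⟩ := hw
  exact update_le_update_iff.2 ⟨Nat.sub_le_sub_right (h c) 1, fun c' _ => h c'⟩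

theorem Performs.le_of_dec {c : C} (hw : (dec c).Performs w w') (h : v ≤ w) (hc : v c = 0) :
    v ≤ w' := by
  obtain ⟨-, rfl⟩ := hw
  exact le_update_iff.2 ⟨by simp [hc], fun c' _ => h c'⟩

/-- Execution of an instruction with incrementing errors before and after it. -/
def PerformsWithErrors (l : CounterInstr C) (v v' : C → ℕ) : Prop :=
  ∃ u u', v ≤ u ∧ l.Performs u u' ∧ u' ≤ v'

end CounterInstr

end Labelling

theorem PosBool.Sat.mono {Q : Type} {P₁ P₁' P₂ P₂' : Set Q} (h : P₁ ⊆ P₂) (h' : P₁' ⊆ P₂')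
    {φ : PosBool Q} (hφ : φ.Sat P₁ P₁') : φ.Sat P₂ P₂' := by
  induction φ with
  | state q => exact h hφ
  | down q => exact h' hφ
  | top => trivial
  | bot => exact hφ
  | and φ ψ ihφ ihψ => exact ⟨ihφ hφ.1, ihψ hφ.2⟩
  | or φ ψ ihφ ihψ => exact hφ.imp ihφ ihψ

/-! ### The counter automaton of a register automaton -/

/-- The states of the counter automaton: `before c` and `after e` record the sets of states that
are paired with the datum of the current position, before and after reading its letter. -/
inductive CounterState (Q : Type) : Type
  | base
  | before (c : Finset Q)
  | after (e : Finset Q)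

namespace CounterState

variable {Q : Type}

def equivOption : Option (Finset Q ⊕ Finset Q) ≃ CounterState Q where
  toFun
    | none => base
    | some (.inl c) => before c
    | some (.inr e) => after e
  invFun
    | base => none
    | before c => some (.inl c)
    | after e => some (.inr e)
  left_inv := by rintro (_ | _ | _) <;> rfl
  right_inv := by rintro (_ | _ | _) <;> rfl

instance [Fintype Q] : Fintype (CounterState Q) := Fintype.ofEquiv _ equivOption

/-- The order in which `ε` transitions pass through the kinds of states. -/
def rank : CounterState Q → ℕ
  | after _ => 0
  | base => 1
  | before _ => 2

end CounterState

namespace SafetyARA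

variable {S : Type} (A : SafetyARA S) {a : S} {c e : Finset A.Q}

noncomputable instance : DecidableEq A.Q := Classical.decEq A.Q

/-- The counters: the sets of states, to each of which the dummy element `none` is added because
counters have to be nonempty. -/
noncomputable def counters : Finset (Finset (Option A.Q)) := {c | none ∈ c}

theorem none_mem_counter (c : A.counters) : none ∈ c.1 := by
  simpa [counters] using c.2

/-- Sets of states as counters. -/
noncomputable def counterEquiv : Finset A.Q ≃ A.counters where
  toFun c := ⟨Finset.insertNone c, by simp [counters]⟩
  invFun c := Finset.eraseNone c.1
  left_inv c := by simp
  right_inv c := by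
    ext x
    cases x <;> simp [A.none_mem_counter c]

theorem mem_counterEquiv_symm {c : A.counters} {q : A.Q} :
    q ∈ A.counterEquiv.symm c ↔ some q ∈ c.1 := by
  simp [counterEquiv]

/-- The sets of states that `d` can turn into at a position with letter `a` and a different
datum, when `e` is available as the set of states for the datum of the position. -/
def Moves (a : S) (e d d' : Finset A.Q) : Prop :=
  ∀ q ∈ d, (A.δ q a false).Sat (d' : Set A.Q) (e : Set A.Q)

/-- The condition for the set of states of the datum of the current position, which has the letter
`a`, to turn from `c` into `e`. -/
def Reads (a : S) (c e : Finset A.Q) : Prop :=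
  ∀ q ∈ c, (A.δ q a true).Sat (e : Set A.Q) (e : Set A.Q)

open scoped Classical in
/-- The transfer for the letter `a` and the set `e` of states. -/
noncomputable def transfer (a : S) (e : Finset A.Q) (d : A.counters) : Finset A.counters :=
  {d' | A.Moves a e (A.counterEquiv.symm d) (A.counterEquiv.symm d')}

theorem mem_transfer {d d' : A.counters} :
    d' ∈ A.transfer a e d ↔ A.Moves a e (A.counterEquiv.symm d) (A.counterEquiv.symm d') := by
  simp [transfer]

theorem isDistributive_transfer (a : S) (e : Finset A.Q) : IsDistributive (A.transfer a e) := by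
  intro c k d d' hcov hd'
  refine ⟨A.counterEquiv (Finset.univ.biUnion fun i => A.counterEquiv.symm (d' i)), ?_, ?_⟩
  · rw [mem_transfer, Equiv.symm_apply_apply]
    intro q hq
    obtain ⟨i, hi⟩ := hcov _ (A.mem_counterEquiv_symm.1 hq)
    refine (A.mem_transfer.1 (hd' i) q (A.mem_counterEquiv_symm.2 hi)).mono ?_ subset_rfl
    exact Finset.coe_subset.2 (Finset.subset_biUnion_of_mem
      (fun i => A.counterEquiv.symm (d' i)) (Finset.mem_univ i))
  · rintro (_ | q) hx
    · obtain ⟨i, -⟩ := hcov none (A.none_mem_counter c)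
      exact ⟨i, A.none_mem_counter _⟩
    · rw [← mem_counterEquiv_symm, Equiv.symm_apply_apply] at hx
      obtain ⟨i, -, hi⟩ := Finset.mem_biUnion.1 hx
      exact ⟨i, A.mem_counterEquiv_symm.1 hi⟩

/-- The transitions of the counter automaton. -/
inductive CounterTrans :
    CounterState A.Q × Option S × CounterInstr A.counters × CounterState A.Q → Prop
  | inc (e : Finset A.Q) : CounterTrans (.after e, none, .inc (A.counterEquiv e), .base)
  | dec (c : Finset A.Q) : CounterTrans (.base, none, .dec (A.counterEquiv c), .before c)
  | read (a : S) (c e : Finset A.Q) (h : A.Reads a c e) :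
      CounterTrans (.before c, some a, .transf (A.transfer a e), .after e)

variable {A} in
theorem CounterTrans.rank_lt {p p' : CounterState A.Q} {l : CounterInstr A.counters}
    (h : A.CounterTrans (p, none, l, p')) : p.rank < p'.rank := by
  cases h <;> simp only [CounterState.rank, Nat.lt_add_one]

/-- The counter automaton, whose counter values are the numbers of data other than that of the
current position for each set of states. -/
noncomputable abbrev toIPCANT : SafetyIPCANT S where
  Q := CounterState A.Q
  init := .before {A.init}
  X := Option A.Q
  C := A.counters
  nonempty_of_mem := fun c hc => ⟨none, A.none_mem_counter ⟨c, hc⟩⟩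
  δ := {t | A.CounterTrans t}
  distributive := by
    rintro _ _ _ _ ⟨⟩
    exact A.isDistributive_transfer _ _
  acyclic := fun q h => by
    have hlt : Relation.TransGen (· < ·) q.rank q.rank :=
      h.lift CounterState.rank fun _ _ ⟨_, ht⟩ => CounterTrans.rank_lt ht
    rw [Relation.transGen_eq_self] at hlt
    exact lt_irrefl _ hlt

theorem toIPCANT_step_iff {w : Option S} {l : CounterInstr A.counters}
    {x x' : CounterState A.Q × (A.counters → ℕ)} :
    A.toIPCANT.Step w l x x' ↔
      A.CounterTrans (x.1, w, l, x'.1) ∧ l.PerformsWithErrors x.2 x'.2 := by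
  constructor
  · rintro ⟨u, u', hu, ⟨ht, hl⟩, hu'⟩
    exact ⟨ht, u, u', hu, hl, hu'⟩
  · rintro ⟨ht, u, u', hu, hl, hu'⟩
    exact ⟨u, u', hu, ⟨ht, hl⟩, hu'⟩

/-- The effect of the counter automaton at a position with letter `a`: reading the letter, and
then the two `ε` transitions that change the current datum. -/
def Round (a : S) (c e : Finset A.Q) (v : A.counters → ℕ) (c' : Finset A.Q)
    (v' : A.counters → ℕ) : Prop :=
  A.Reads a c e ∧ ∃ v₁ v₂,
    (CounterInstr.transf (A.transfer a e)).PerformsWithErrors v v₁ ∧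
    (CounterInstr.inc (A.counterEquiv e)).PerformsWithErrors v₁ v₂ ∧
    (CounterInstr.dec (A.counterEquiv c')).PerformsWithErrors v₂ v'

end SafetyARA

theorem exists_seq_of_forall_exists {α : Type*} (I : ℕ → α → Prop) (R : ℕ → α → α → Prop) {a : α}
    (ha : I 0 a) (h : ∀ n x, I n x → ∃ y, I (n + 1) y ∧ R n x y) :
    ∃ x : ℕ → α, ∀ n, I n (x n) ∧ R n (x n) (x (n + 1)) := by
  choose! g hg using h
  let x : ℕ → α := fun n => Nat.rec a g n
  have hx : ∀ n, I n (x n) := by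
    intro n
    induction n with
    | zero => exact ha
    | succ n ih => exact (hg n _ ih).1
  exact ⟨x, fun n => ⟨hx n, (hg n _ (hx n)).2⟩⟩

/-- The sequence `f 0, g 0, h 0, f 1, g 1, h 1, …`. -/
def interleave {α : Type*} (f g h : ℕ → α) (j : ℕ) : α :=
  match j % 3 with
  | 0 => f (j / 3)
  | 1 => g (j / 3)
  | _ => h (j / 3)

section Interleave

variable {α : Type*} (f g h : ℕ → α) (i : ℕ)

theorem interleave_three_mul : interleave f g h (3 * i) = f i := by
  simp [interleave]

theorem interleave_three_mul_add_one : interleave f g h (3 * i + 1) = g i := by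
  simp [interleave, Nat.mul_add_div]

theorem interleave_three_mul_add_two : interleave f g h (3 * i + 2) = h i := by
  simp [interleave, Nat.mul_add_div]

theorem forall_iff_forall_three_mul {P : ℕ → Prop} :
    (∀ j, P j) ↔ ∀ i, P (3 * i) ∧ P (3 * i + 1) ∧ P (3 * i + 2) := by
  refine ⟨fun h i => ⟨h _, h _, h _⟩, fun h j => ?_⟩
  have hj : j = 3 * (j / 3) ∨ j = 3 * (j / 3) + 1 ∨ j = 3 * (j / 3) + 2 := by omega
  rcases hj with hj | hj | hj <;> rw [hj]
  exacts [(h _).1, (h _).2.1, (h _).2.2]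

theorem spellsWord_iff_of_three_mul {S : Type} {lab : ℕ → Option S} {a w : ℕ → S}
    (h₀ : ∀ i, lab (3 * i) = some (a i)) (h₁ : ∀ i, lab (3 * i + 1) = none)
    (h₂ : ∀ i, lab (3 * i + 2) = none) : SafetyIPCANT.SpellsWord lab w ↔ a = w := by
  have hmono : StrictMono fun i => 3 * i := fun m n h => by dsimp only; omega
  have hlab : ∀ j, lab j ≠ none ↔ j ∈ Set.range fun i => 3 * i := by
    simp only [Set.mem_range]
    refine forall_iff_forall_three_mul.2 fun i => ⟨?_, ?_, ?_⟩
    · simp [h₀]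
    · simp only [h₁, ne_eq, not_true_eq_false, false_iff, not_exists]
      omega
    · simp only [h₂, ne_eq, not_true_eq_false, false_iff, not_exists]
      omega
  constructor
  · rintro ⟨φ, hφ, hw, hnone⟩
    obtain rfl : φ = fun i => 3 * i := by
      rw [← hφ.range_inj hmono]
      ext j
      rw [← hlab]
      refine ⟨?_, fun hj => by_contra fun h => hj (hnone j h)⟩
      rintro ⟨i, rfl⟩
      simp [hw]
    exact funext fun i => Option.some.inj ((h₀ i).symm.trans (hw i))
  · rintro rfl
    exact ⟨_, hmono, h₀, fun j hj => by_contra fun h => hj ((hlab j).1 h)⟩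

end Interleave

namespace SafetyARA

variable {S : Type} (A : SafetyARA S) {a : S} {c e c' : Finset A.Q} {v v' : A.counters → ℕ}

theorem exists_round_of_steps {y y₁ y₂ y₃ : CounterState A.Q × (A.counters → ℕ)}
    {w w₁ w₂ : Option S} {l l₁ l₂ : CounterInstr A.counters} (hy : y = (.before c, v))
    (h : A.toIPCANT.Step w l y y₁) (h₁ : A.toIPCANT.Step w₁ l₁ y₁ y₂)
    (h₂ : A.toIPCANT.Step w₂ l₂ y₂ y₃) :
    ∃ a e c' v', w = some a ∧ w₁ = none ∧ w₂ = none ∧ A.Round a c e v c' v' ∧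
      y₃ = (.before c', v') := by
  obtain ⟨p₁, v₁⟩ := y₁
  obtain ⟨p₂, v₂⟩ := y₂
  obtain ⟨p₃, v'⟩ := y₃
  subst hy
  rw [toIPCANT_step_iff] at h h₁ h₂
  obtain ⟨ht, h⟩ := h
  obtain ⟨ht₁, h₁⟩ := h₁
  obtain ⟨ht₂, h₂⟩ := h₂
  cases ht with
  | read a _ e hr =>
    cases ht₁
    cases ht₂ with
    | dec c' => exact ⟨a, e, c', v', rfl, rfl, rfl, ⟨hr, v₁, v₂, h, h₁, h₂⟩, rfl⟩

theorem exists_rounds_of_toIPCANT_accepts {w : ℕ → S} (h : A.toIPCANT.Accepts w) :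
    ∃ (c e : ℕ → Finset A.Q) (v : ℕ → A.counters → ℕ), c 0 = {A.init} ∧
      ∀ i, A.Round (w i) (c i) (e i) (v i) (c (i + 1)) (v (i + 1)) := by
  obtain ⟨x, lab, l, h0, hs, hw⟩ := h
  have hround (i : ℕ) (c v) (hx : x (3 * i) = (.before c, v)) :=
    A.exists_round_of_steps hx (hs (3 * i)) (hs (3 * i + 1)) (hs (3 * i + 2))
  have hbefore (i : ℕ) : ∃ c v, x (3 * i) = (.before c, v) := by
    induction i with
    | zero => exact ⟨_, _, h0⟩
    | succ i ih =>
      obtain ⟨c, v, hx⟩ := ih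
      obtain ⟨_, _, c', v', -, -, -, -, hx'⟩ := hround i c v hx
      exact ⟨c', v', hx'⟩
  choose c v hx using hbefore
  choose a e c' v' h₀ h₁ h₂ hr hx' using fun i => hround i (c i) (v i) (hx i)
  obtain rfl : a = w := (spellsWord_iff_of_three_mul h₀ h₁ h₂).1 hw
  have hnext (i : ℕ) : c' i = c (i + 1) ∧ v' i = v (i + 1) := by
    simpa only [Prod.mk.injEq, CounterState.before.injEq] using (hx' i).symm.trans (hx (i + 1))
  refine ⟨c, e, v, ?_, fun i => ?_⟩
  · simpa only [Prod.mk.injEq, CounterState.before.injEq] using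
      congrArg Prod.fst ((hx 0).symm.trans h0)
  · rw [← (hnext i).1, ← (hnext i).2]
    exact hr i

theorem toIPCANT_accepts_of_rounds {w : ℕ → S} {c e : ℕ → Finset A.Q} {v : ℕ → A.counters → ℕ}
    (hc : c 0 = {A.init}) (hv : v 0 = 0)
    (h : ∀ i, A.Round (w i) (c i) (e i) (v i) (c (i + 1)) (v (i + 1))) :
    A.toIPCANT.Accepts w := by
  choose hr v₁ v₂ hread hinc hdec using h
  refine ⟨interleave (fun i => (.before (c i), v i)) (fun i => (.after (e i), v₁ i))
      (fun i => (.base, v₂ i)),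
    interleave (fun i => some (w i)) (fun _ => none) (fun _ => none),
    interleave (fun i => .transf (A.transfer (w i) (e i))) (fun i => .inc (A.counterEquiv (e i)))
      (fun i => .dec (A.counterEquiv (c (i + 1)))), ?_, ?_, ?_⟩
  · change (CounterState.before (c 0), v 0) = (.before {A.init}, 0)
    rw [hc, hv]
  · refine forall_iff_forall_three_mul.2 fun i => ?_
    rw [show 3 * i + 2 + 1 = 3 * (i + 1) by ring]
    simp only [toIPCANT_step_iff, interleave_three_mul, interleave_three_mul_add_one,
      interleave_three_mul_add_two]
    exact ⟨⟨.read _ _ _ (hr i), hread i⟩, ⟨.inc _, hinc i⟩, ⟨.dec _, hdec i⟩⟩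
  · exact (spellsWord_iff_of_three_mul (interleave_three_mul _ _ _)
      (interleave_three_mul_add_one _ _ _) (interleave_three_mul_add_two _ _ _)).2 rfl

/-- The counter values for the data in `B`, when `lab` assigns sets of states to data. -/
noncomputable def countVal {ι : Type} (B : Finset ι) (lab : ι → Finset A.Q) : A.counters → ℕ :=
  labelCount B fun D => A.counterEquiv (lab D)

theorem performsWithErrors_transfer {ι : Type} {B : Finset ι} {lab lab' : ι → Finset A.Q}
    (h : ∀ D ∈ B, A.Moves a e (lab D) (lab' D)) :
    (CounterInstr.transf (A.transfer a e)).PerformsWithErrors (A.countVal B lab)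
      (A.countVal B lab') := by
  refine ⟨_, _, le_rfl, CounterInstr.performs_transf_labelCount fun D hD => ?_, le_rfl⟩
  rw [mem_transfer, Equiv.symm_apply_apply, Equiv.symm_apply_apply]
  exact h D hD

/-! ### From runs of the register automaton to runs of the counter automaton -/

section Soundness

variable {σ : DataWord S} {i : ℕ} {F F' : Finset (A.Config σ)}

open scoped Classical in
/-- The set of states that are paired with the datum `D` in `F`. -/
noncomputable def statesAt (F : Finset (A.Config σ)) (D : σ.Datum) : Finset A.Q :=
  {q | (q, D) ∈ F}

variable {A}

theorem mem_statesAt {D : σ.Datum} {q : A.Q} : q ∈ A.statesAt F D ↔ (q, D) ∈ F := by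
  simp [statesAt]

theorem Step.sat_statesAt (h : A.Step σ i F F') {q : A.Q} {D : σ.Datum} (hq : (q, D) ∈ F) :
    (D = σ.cls i → (A.δ q (σ.str i) true).Sat (A.statesAt F' D : Set A.Q)
      (A.statesAt F' (σ.cls i) : Set A.Q)) ∧
    (D ≠ σ.cls i → (A.δ q (σ.str i) false).Sat (A.statesAt F' D : Set A.Q)
      (A.statesAt F' (σ.cls i) : Set A.Q)) := by
  obtain ⟨P, P', hsat, hF'⟩ := h
  have hP : P (q, D) ⊆ A.statesAt F' D := fun q' hq' => by
    rw [Finset.mem_coe, mem_statesAt, ← Finset.mem_coe, hF']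
    exact Or.inl ⟨q, D, hq, q', hq', rfl⟩
  have hP' : P' (q, D) ⊆ A.statesAt F' (σ.cls i) := fun q' hq' => by
    rw [Finset.mem_coe, mem_statesAt, ← Finset.mem_coe, hF']
    exact Or.inr ⟨q, D, hq, q', hq', rfl⟩
  exact ⟨fun hD => ((hsat q D hq).1 hD).mono hP hP', fun hD => ((hsat q D hq).2 hD).mono hP hP'⟩

theorem Step.reads_statesAt (h : A.Step σ i F F') :
    A.Reads (σ.str i) (A.statesAt F (σ.cls i)) (A.statesAt F' (σ.cls i)) :=
  fun _ hq => (h.sat_statesAt (mem_statesAt.1 hq)).1 rfl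

theorem Step.moves_statesAt (h : A.Step σ i F F') {D : σ.Datum} (hD : D ≠ σ.cls i) :
    A.Moves (σ.str i) (A.statesAt F' (σ.cls i)) (A.statesAt F D) (A.statesAt F' D) :=
  fun _ hq => (h.sat_statesAt (mem_statesAt.1 hq)).2 hD

open scoped Classical in
/-- The data of the positions up to `i`. -/
noncomputable def dataUpTo (σ : DataWord S) (i : ℕ) : Finset σ.Datum :=
  (Finset.range (i + 1)).image σ.cls

theorem cls_mem_dataUpTo : σ.cls i ∈ dataUpTo σ i := by
  classical
  exact Finset.mem_image_of_mem _ (Finset.self_mem_range_succ i)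

theorem dataUpTo_subset_succ : dataUpTo σ i ⊆ dataUpTo σ (i + 1) := by
  classical
  exact Finset.image_subset_image (Finset.range_subset_range.2 (Nat.le_succ _))

open scoped Classical in
theorem Step.round (h : A.Step σ i F F') :
    A.Round (σ.str i) (A.statesAt F (σ.cls i)) (A.statesAt F' (σ.cls i))
      (A.countVal ((dataUpTo σ i).erase (σ.cls i)) (A.statesAt F))
      (A.statesAt F' (σ.cls (i + 1)))
      (A.countVal ((dataUpTo σ (i + 1)).erase (σ.cls (i + 1))) (A.statesAt F')) :=
  ⟨h.reads_statesAt, A.countVal ((dataUpTo σ i).erase (σ.cls i)) (A.statesAt F'),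
    A.countVal (dataUpTo σ (i + 1)) (A.statesAt F'),
    A.performsWithErrors_transfer fun _ hD => h.moves_statesAt (Finset.ne_of_mem_erase hD),
    ⟨_, _, le_rfl, CounterInstr.performs_inc_labelCount cls_mem_dataUpTo _,
      labelCount_mono dataUpTo_subset_succ _⟩,
    ⟨_, _, le_rfl, CounterInstr.performs_dec_labelCount cls_mem_dataUpTo _, le_rfl⟩⟩

theorem toIPCANT_accepts_of_accepts (h : A.Accepts σ) : A.toIPCANT.Accepts σ.str := by
  classical
  obtain ⟨F, hF0, hF⟩ := h
  refine A.toIPCANT_accepts_of_rounds (c := fun i => A.statesAt (F i) (σ.cls i))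
    (v := fun i => A.countVal ((dataUpTo σ i).erase (σ.cls i)) (A.statesAt (F i))) ?_ ?_
    fun i => (hF i).round
  · ext q
    simp [mem_statesAt, hF0]
  · have : (dataUpTo σ 0).erase (σ.cls 0) = ∅ := by simp [dataUpTo]
    rw [this]
    exact labelCount_empty

end Soundness

/-! ### From runs of the counter automaton to runs of the register automaton -/

section Completeness

/-- A data word and a run of `A` under construction: the data used so far, the current one among
them, and the sets of states paired with the data. -/
structure Tracking where
  data : Finset ℕ
  lab : ℕ → Finset A.Q
  cur : ℕ

variable {A} {s s' : A.Tracking}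

/-- The effect of a position with letter `a`, whose datum gets the set `e` of states. -/
structure Tracking.Next (a : S) (e : Finset A.Q) (s s' : A.Tracking) : Prop where
  moves : ∀ D ∈ s.data.erase s.cur, A.Moves a e (s.lab D) (s'.lab D)
  lab_cur : s'.lab s.cur = e
  subset : s.data ⊆ s'.data

/-- The current datum has the set `c` of states, and `v` covers the other data. -/
structure Tracking.Covered (c : Finset A.Q) (v : A.counters → ℕ) (s : A.Tracking) : Prop where
  cur_mem : s.cur ∈ s.data
  lab_cur : s.lab s.cur = c
  le : A.countVal (s.data.erase s.cur) s.lab ≤ v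

theorem exists_moves_of_performsWithErrors_transfer
    (h : (CounterInstr.transf (A.transfer a e)).PerformsWithErrors v v')
    {ι : Type} {B : Finset ι} {lab : ι → Finset A.Q} (hle : A.countVal B lab ≤ v) :
    ∃ lab' : ι → Finset A.Q, (∀ D ∈ B, A.Moves a e (lab D) (lab' D)) ∧
      A.countVal B lab' ≤ v' := by
  obtain ⟨u, u', hu, hp, hu'⟩ := h
  obtain ⟨lab', hmem, hle'⟩ := CounterInstr.exists_labelling_of_performs_transf hp (hle.trans hu)
  refine ⟨fun D => A.counterEquiv.symm (lab' D), fun D hD => ?_, ?_⟩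
  · simpa only [mem_transfer, Equiv.symm_apply_apply] using hmem D hD
  · simpa only [countVal, Equiv.apply_symm_apply] using hle'.trans hu'

theorem countVal_le_of_performsWithErrors_inc {ι : Type} [DecidableEq ι] {B : Finset ι} {D : ι}
    {lab : ι → Finset A.Q}
    (h : (CounterInstr.inc (A.counterEquiv (lab D))).PerformsWithErrors v v') (hD : D ∈ B)
    (hle : A.countVal (B.erase D) lab ≤ v) : A.countVal B lab ≤ v' := by
  obtain ⟨u, u', hu, hp, hu'⟩ := h
  exact ((CounterInstr.performs_inc_labelCount hD _).inc_mono hp (hle.trans hu)).trans hu'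

/-- If no datum has the set `c` of states, then the decrement has used an incrementing error,
which is imitated by a fresh datum. -/
theorem exists_datum_of_performsWithErrors_dec {B : Finset ℕ} {lab : ℕ → Finset A.Q}
    (h : (CounterInstr.dec (A.counterEquiv c)).PerformsWithErrors v v')
    (hle : A.countVal B lab ≤ v) :
    ∃ (B' : Finset ℕ) (lab' : ℕ → Finset A.Q), ∃ D ∈ B', B ⊆ B' ∧ (∀ E ∈ B, lab' E = lab E) ∧
      lab' D = c ∧ A.countVal (B'.erase D) lab' ≤ v' := by
  obtain ⟨u, u', hu, hp, hu'⟩ := h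
  by_cases hc : ∃ D ∈ B, lab D = c
  · obtain ⟨D, hD, rfl⟩ := hc
    exact ⟨B, lab, D, hD, subset_rfl, fun _ _ => rfl, rfl,
      ((CounterInstr.performs_dec_labelCount hD _).dec_mono hp (hle.trans hu)).trans hu'⟩
  · push Not at hc
    obtain ⟨D, hD⟩ := Infinite.exists_notMem_finset B
    have hagree : ∀ E ∈ B, Function.update lab D c E = lab E := fun E hE =>
      Function.update_of_ne (ne_of_mem_of_not_mem hE hD) ..
    refine ⟨insert D B, Function.update lab D c, D, Finset.mem_insert_self D B,
      Finset.subset_insert D B, hagree, Function.update_self .., ?_⟩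
    have hzero : A.countVal B lab (A.counterEquiv c) = 0 :=
      labelCount_eq_zero fun E hE h => hc E hE (A.counterEquiv.injective h)
    rw [Finset.erase_insert hD, countVal, labelCount_congr fun E hE => by rw [hagree E hE]]
    exact (hp.le_of_dec (hle.trans hu) hzero).trans hu'

theorem Tracking.Covered.exists_next (hs : s.Covered c v) (h : A.Round a c e v c' v') :
    ∃ s' : A.Tracking, s'.Covered c' v' ∧ s.Next a e s' := by
  obtain ⟨-, v₁, v₂, hread, hinc, hdec⟩ := h
  obtain ⟨lab₁, hmoves, hle₁⟩ := exists_moves_of_performsWithErrors_transfer hread hs.le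
  let lab₂ := Function.update lab₁ s.cur e
  have hcur : lab₂ s.cur = e := Function.update_self ..
  have hagree : ∀ D ∈ s.data.erase s.cur, lab₂ D = lab₁ D := fun D hD =>
    Function.update_of_ne (Finset.ne_of_mem_erase hD) ..
  have hle₂ : A.countVal s.data lab₂ ≤ v₂ := by
    rw [← hcur] at hinc
    refine countVal_le_of_performsWithErrors_inc hinc hs.cur_mem (le_trans (le_of_eq ?_) hle₁)
    exact labelCount_congr fun D hD => by rw [hagree D hD]
  obtain ⟨B, lab, D, hD, hsub, hlab, hlabD, hle⟩ :=
    exists_datum_of_performsWithErrors_dec hdec hle₂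
  refine ⟨⟨B, lab, D⟩, ⟨hD, hlabD, hle⟩, ⟨fun E hE => ?_, ?_, hsub⟩⟩
  · change A.Moves a e (s.lab E) (lab E)
    rw [hlab E (Finset.mem_of_mem_erase hE), hagree E hE]
    exact hmoves E hE
  · exact (hlab _ hs.cur_mem).trans hcur

variable (A) in
/-- The run of `A` in which every configuration at position `i` with datum `D` has as successors
all states of `lab (i + 1) D`, with datum `D`, and of `e i`, with the datum of position `i`. -/
noncomputable def maximalRun (σ : DataWord S) (lab : ℕ → σ.Datum → Finset A.Q)
    (e : ℕ → Finset A.Q) : ℕ → Finset (A.Config σ)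
  | 0 => {(A.init, σ.cls 0)}
  | i + 1 =>
    open scoped Classical in
    (maximalRun σ lab e i).biUnion fun x => (lab (i + 1) x.2).image (fun q => (q, x.2)) ∪
      (e i).image (fun q => (q, σ.cls i))

theorem mem_maximalRun_succ {σ : DataWord S} {lab : ℕ → σ.Datum → Finset A.Q}
    {e : ℕ → Finset A.Q} {i : ℕ} {x : A.Config σ} :
    x ∈ A.maximalRun σ lab e (i + 1) ↔
      (∃ q D, (q, D) ∈ A.maximalRun σ lab e i ∧ ∃ q' ∈ lab (i + 1) D, x = (q', D)) ∨
      ∃ q D, (q, D) ∈ A.maximalRun σ lab e i ∧ ∃ q' ∈ e i, x = (q', σ.cls i) := by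
  simp only [maximalRun, Finset.mem_biUnion, Finset.mem_union, Finset.mem_image, Prod.exists,
    and_or_left, exists_or, eq_comm (a := x)]

/-- The data word in which the datum of position `i` is `(s i).cur`. -/
def trackedWord (w : ℕ → S) (s : ℕ → A.Tracking) : DataWord S :=
  ⟨w, Setoid.ker fun i => (s i).cur⟩

/-- The number that represents a datum in the trackings. -/
def trackedDatum {w : ℕ → S} {s : ℕ → A.Tracking} : (trackedWord w s).Datum → ℕ :=
  Quotient.lift (fun i => (s i).cur) fun _ _ h => h

theorem trackedDatum_injective {w : ℕ → S} {s : ℕ → A.Tracking} :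
    Function.Injective (trackedDatum (w := w) (s := s)) :=
  Quotient.ind₂ fun _ _ h => Quotient.sound h

section TrackedWord

variable {w : ℕ → S} {s : ℕ → A.Tracking} {e : ℕ → Finset A.Q}

theorem mem_of_mem_maximalRun (hinit : A.init ∈ (s 0).lab (s 0).cur)
    (hcur : ∀ i, (s i).cur ∈ (s i).data) (hnext : ∀ i, (s i).Next (w i) (e i) (s (i + 1)))
    {i : ℕ} {q : A.Q} {D : (trackedWord w s).Datum}
    (h : (q, D) ∈ A.maximalRun (trackedWord w s) (fun i D => (s i).lab (trackedDatum D)) e i) :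
    trackedDatum D ∈ (s i).data ∧ q ∈ (s i).lab (trackedDatum D) := by
  induction i generalizing q D with
  | zero =>
    obtain ⟨rfl, rfl⟩ := Prod.mk.inj (Finset.mem_singleton.1 h)
    exact ⟨hcur 0, hinit⟩
  | succ i ih =>
    rcases mem_maximalRun_succ.1 h with ⟨q₀, D₀, h₀, q', hq', heq⟩ | ⟨q₀, D₀, _, q', hq', heq⟩ <;>
      obtain ⟨rfl, rfl⟩ := Prod.mk.inj heq
    · exact ⟨(hnext i).subset (ih h₀).1, hq'⟩
    · refine ⟨(hnext i).subset (hcur i), ?_⟩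
      rwa [← (hnext i).lab_cur] at hq'

theorem accepts_trackedWord (hinit : (s 0).lab (s 0).cur = {A.init})
    (hreads : ∀ i, A.Reads (w i) ((s i).lab (s i).cur) (e i)) (hcur : ∀ i, (s i).cur ∈ (s i).data)
    (hnext : ∀ i, (s i).Next (w i) (e i) (s (i + 1))) : A.Accepts (trackedWord w s) := by
  let σ := trackedWord w s
  refine ⟨A.maximalRun σ (fun i D => (s i).lab (trackedDatum D)) e, rfl, fun i =>
    ⟨fun x => (s (i + 1)).lab (trackedDatum x.2), fun _ => e i, fun q D h => ?_, ?_⟩⟩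
  · obtain ⟨hD, hq⟩ := mem_of_mem_maximalRun (by simp [hinit]) hcur hnext h
    constructor
    · rintro rfl
      change (A.δ q (w i) true).Sat ((s (i + 1)).lab (s i).cur) (e i)
      rw [(hnext i).lab_cur]
      exact hreads i q hq
    · intro hne
      refine (hnext i).moves _ (Finset.mem_erase.2 ⟨fun heq => hne ?_, hD⟩) q hq
      exact trackedDatum_injective heq
  · ext x
    exact mem_maximalRun_succ

end TrackedWord

theorem exists_accepts_of_toIPCANT_accepts {w : ℕ → S} (h : A.toIPCANT.Accepts w) :
    ∃ σ : DataWord S, A.Accepts σ ∧ σ.str = w := by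
  obtain ⟨c, e, v, hc, hround⟩ := A.exists_rounds_of_toIPCANT_accepts h
  obtain ⟨s, hs⟩ := exists_seq_of_forall_exists
    (fun i (s : A.Tracking) => s.Covered (c i) (v i)) (fun i s s' => s.Next (w i) (e i) s')
    (a := ⟨{0}, fun _ => {A.init}, 0⟩)
    ⟨Finset.mem_singleton_self 0, hc.symm, by simp [countVal, labelCount_empty]⟩
    fun i s hs => hs.exists_next (hround i)
  refine ⟨trackedWord w s, accepts_trackedWord (e := e) ?_ (fun i => ?_)
    (fun i => (hs i).1.cur_mem) (fun i => (hs i).2), rfl⟩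
  · rw [(hs 0).1.lab_cur, hc]
  · rw [(hs i).1.lab_cur]
    exact (hround i).1

end Completeness

theorem toIPCANT_language : A.toIPCANT.language = DataWord.str '' A.language := by
  ext w
  constructor
  · intro h
    obtain ⟨σ, hσ, rfl⟩ := exists_accepts_of_toIPCANT_accepts h
    exact ⟨σ, hσ, rfl⟩
  · rintro ⟨σ, hσ, rfl⟩
    exact A.toIPCANT_accepts_of_accepts hσ

end SafetyARA

/-! ### Structured programs for machines with stacks -/

namespace Prog

/-- Statements of the machines that run programs.  Such a machine records in its state whether the
last pop succeeded. -/
abbrev Code {K : Type} (Γ : K → Type) (σ Λ : Type) : Type := Turing.TM2.Stmt Γ Λ (Bool × σ)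

/-- Conditions of conditionals and loops: a test of the internal state, or an attempt to pop a
symbol off a stack, which fails, without any effect, if the stack is empty. -/
inductive Guard {K : Type} (Γ : K → Type) (σ : Type) : Type
  | test (c : σ → Bool)
  | pop (k : K) (f : σ → Γ k → σ)

namespace Guard

variable {K : Type} {Γ : K → Type} {σ : Type}

/-- The effect of a guard; the value is `none` if the guard fails. -/
def eval [DecidableEq K] :
    Guard Γ σ → σ → (∀ k, List (Γ k)) → Option (σ × ∀ k, List (Γ k))
  | test c, v, S => if c v then some (v, S) else none
  | pop k f, v, S => match S k with
    | [] => none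
    | x :: l => some (f v x, Function.update S k l)

/-- The update of the machine state by a pop. -/
def onPop {α : Type} (f : σ → α → σ) (v : Bool × σ) : Option α → Bool × σ
  | none => (false, v.2)
  | some x => (true, f v.2 x)

/-- The compiled guard, which jumps to `yes` on success and continues as `no` on failure. -/
def code {Λ : Type} (yes : Λ) (no : Code Γ σ Λ) : Guard Γ σ → Code Γ σ Λ
  | test c => .branch (fun v => c v.2) (.goto fun _ => yes) no
  | pop k f => .pop k (onPop f) <| .branch (fun v => v.1) (.goto fun _ => yes) no

/-- The credit available after the guard has succeeded; see `Prog.credit`. -/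
def credit [DecidableEq K] (w : K → ℕ) (out : K) : Guard Γ σ → ℕ → Option ℕ
  | test _, a => some a
  | pop k _, a => if k = out then none else some (a + w k)

theorem neverReads_code [DecidableEq K] {w : K → ℕ} {out : K} {Λ : Type} {yes : Λ}
    {no : Code Γ σ Λ} {g : Guard Γ σ} {a b : ℕ} (h : g.credit w out a = some b)
    (hno : NeverReads out no) : NeverReads out (g.code yes no) := by
  cases g with
  | test c => exact ⟨trivial, hno⟩
  | pop k f =>
    rw [credit, Option.ite_none_left_eq_some] at h
    exact ⟨h.1, trivial, hno⟩

theorem stepAux_code_of_eval_eq_some [DecidableEq K] {Λ : Type} {yes : Λ} {no : Code Γ σ Λ}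
    {g : Guard Γ σ} {v v₁ : σ} {S S₁ : ∀ k, List (Γ k)} (h : g.eval v S = some (v₁, S₁))
    (β : Bool) : ∃ β', Turing.TM2.stepAux (g.code yes no) (β, v) S = ⟨some yes, (β', v₁), S₁⟩ := by
  cases g with
  | test c =>
    simp only [eval, Option.ite_none_right_eq_some, Option.some.injEq, Prod.mk.injEq] at h
    obtain ⟨hc, rfl, rfl⟩ := h
    exact ⟨β, by simp [code, hc]⟩
  | pop k f =>
    cases hS : S k with
    | nil => simp [eval, hS] at h
    | cons x l =>
      simp only [eval, hS, Option.some.injEq, Prod.mk.injEq] at h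
      obtain ⟨rfl, rfl⟩ := h
      exact ⟨true, by simp [code, onPop, hS]⟩

theorem stepAux_code_of_eval_eq_none [DecidableEq K] {Λ : Type} {yes : Λ} {no : Code Γ σ Λ}
    {g : Guard Γ σ} {v : σ} {S : ∀ k, List (Γ k)} (h : g.eval v S = none) (β : Bool) :
    ∃ β', Turing.TM2.stepAux (g.code yes no) (β, v) S = Turing.TM2.stepAux no (β', v) S := by
  cases g with
  | test c =>
    have hc : c v = false := by simpa [eval] using h
    exact ⟨β, by simp [code, hc]⟩
  | pop k f =>
    cases hS : S k with
    | nil =>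
      have hup : Function.update S k [] = S := by rw [← hS, Function.update_eq_self]
      exact ⟨false, by simp [code, onPop, hS, hup]⟩
    | cons x l => simp [eval, hS] at h

end Guard

end Prog

/-- Structured programs over stacks `Γ` and an internal state in `σ`. -/
inductive Prog {K : Type} (Γ : K → Type) (σ : Type) : Type
  | load (f : σ → σ)
  | push (k : K) (f : σ → Γ k)
  | ite (g : Prog.Guard Γ σ) (p q : Prog Γ σ)
  | loop (g : Prog.Guard Γ σ) (p : Prog Γ σ)
  | seq (p q : Prog Γ σ)

namespace Prog

variable {K : Type} {Γ : K → Type} {σ : Type}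

/-- Big-step semantics. -/
inductive Exec [DecidableEq K] :
    Prog Γ σ → σ → (∀ k, List (Γ k)) → σ → (∀ k, List (Γ k)) → Prop
  | load (f v S) : Exec (.load f) v S (f v) S
  | push (k f v S) : Exec (.push k f) v S v (Function.update S k (f v :: S k))
  | ite_some {g p q v S v₁ S₁ v' S'} : g.eval v S = some (v₁, S₁) →
      Exec p v₁ S₁ v' S' → Exec (.ite g p q) v S v' S'
  | ite_none {g p q v S v' S'} : g.eval v S = none →
      Exec q v S v' S' → Exec (.ite g p q) v S v' S'
  | loop_some {g p v S v₁ S₁ v₂ S₂ v' S'} : g.eval v S = some (v₁, S₁) →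
      Exec p v₁ S₁ v₂ S₂ → Exec (.loop g p) v₂ S₂ v' S' → Exec (.loop g p) v S v' S'
  | loop_none {g p v S} : g.eval v S = none → Exec (.loop g p) v S v S
  | seq {p q v S v₁ S₁ v' S'} : Exec p v S v₁ S₁ → Exec q v₁ S₁ v' S' →
      Exec (.seq p q) v S v' S'

/-- The labels of the compiled program. -/
def Lab : Prog Γ σ → Type
  | load _ => Unit
  | push _ _ => Unit
  | ite _ p q => Option (Lab p ⊕ Lab q)
  | loop _ p => Option (Lab p)
  | seq p q => Lab p ⊕ Lab q

instance finite_lab : ∀ p : Prog Γ σ, Finite p.Lab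
  | load _ => inferInstanceAs (Finite Unit)
  | push _ _ => inferInstanceAs (Finite Unit)
  | ite _ p q =>
    haveI := finite_lab p
    haveI := finite_lab q
    inferInstanceAs (Finite (Option (Lab p ⊕ Lab q)))
  | loop _ p =>
    haveI := finite_lab p
    inferInstanceAs (Finite (Option (Lab p)))
  | seq p q =>
    haveI := finite_lab p
    haveI := finite_lab q
    inferInstanceAs (Finite (Lab p ⊕ Lab q))

/-- The label at which the compiled program starts. -/
def entry : (p : Prog Γ σ) → p.Lab
  | load _ => ()
  | push _ _ => ()
  | ite _ _ _ => none
  | loop _ _ => none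
  | seq p _ => Sum.inl p.entry

/-- The compiled program, when labels are embedded by `emb` and `ex` is performed at the end. -/
def code {Λ : Type} : (p : Prog Γ σ) → (p.Lab → Λ) → Code Γ σ Λ → p.Lab → Code Γ σ Λ
  | load f, _, ex, _ => .load (fun v => (v.1, f v.2)) ex
  | push k f, _, ex, _ => .push k (fun v => f v.2) ex
  | ite _ p _, emb, ex, some (.inl l) => p.code (fun l => emb (some (.inl l))) ex l
  | ite _ _ q, emb, ex, some (.inr l) => q.code (fun l => emb (some (.inr l))) ex l
  | ite g p q, emb, _, none =>
      g.code (emb (some (.inl p.entry))) (.goto fun _ => emb (some (.inr q.entry)))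
  | loop _ p, emb, _, some l => p.code (fun l => emb (some l)) (.goto fun _ => emb none) l
  | loop g p, emb, ex, none => g.code (emb (some p.entry)) ex
  | seq p q, emb, _, .inl l =>
      p.code (fun l => emb (.inl l)) (.goto fun _ => emb (.inr q.entry)) l
  | seq _ q, emb, ex, .inr l => q.code (fun l => emb (.inr l)) ex l

/-- Static check of space: every symbol on stack `k` weighs `w k`, pushing has to be paid for by
previous pops, loops must not lose credit, and `out` is not popped.  The result is the credit that
remains. -/
def credit [DecidableEq K] (w : K → ℕ) (out : K) : Prog Γ σ → ℕ → Option ℕ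
  | load _, a => some a
  | push k _, a => if w k ≤ a then some (a - w k) else none
  | ite g p q, a => (g.credit w out a).bind fun a₁ =>
      (p.credit w out a₁).bind fun b => (q.credit w out a).bind fun b' => some (min b b')
  | loop g p, a => (g.credit w out a).bind fun a₁ =>
      (p.credit w out a₁).bind fun b => if a ≤ b then some a else none
  | seq p q, a => (p.credit w out a).bind fun b => q.credit w out b

section Credit

variable [DecidableEq K] {w : K → ℕ} {out : K} {g : Guard Γ σ} {p q : Prog Γ σ} {a b : ℕ}

theorem credit_ite_eq_some : (ite g p q).credit w out a = some b ↔
    ∃ a₁ b₁ b₂, g.credit w out a = some a₁ ∧ p.credit w out a₁ = some b₁ ∧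
      q.credit w out a = some b₂ ∧ min b₁ b₂ = b := by
  simp only [credit, Option.bind_eq_some_iff, Option.some.injEq]
  tauto

theorem credit_loop_eq_some : (loop g p).credit w out a = some b ↔
    ∃ a₁ b₁, g.credit w out a = some a₁ ∧ p.credit w out a₁ = some b₁ ∧ a ≤ b₁ ∧ a = b := by
  simp only [credit, Option.bind_eq_some_iff, Option.ite_none_right_eq_some, Option.some.injEq]
  tauto

theorem credit_seq_eq_some : (seq p q).credit w out a = some b ↔
    ∃ b₁, p.credit w out a = some b₁ ∧ q.credit w out b₁ = some b := by
  simp only [credit, Option.bind_eq_some_iff]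

end Credit

theorem neverReads_code [DecidableEq K] {w : K → ℕ} {out : K} {Λ : Type} (p : Prog Γ σ) :
    ∀ {a b : ℕ} {emb : p.Lab → Λ} {ex : Code Γ σ Λ}, p.credit w out a = some b →
      NeverReads out ex → ∀ l, NeverReads out (p.code emb ex l) := by
  induction p with
  | load f => exact fun _ h _ => h
  | push k f => exact fun _ h _ => h
  | ite g p q ihp ihq =>
    intro a b emb ex hc hex l
    obtain ⟨a₁, b₁, b₂, hg, hp, hq, -⟩ := credit_ite_eq_some.1 hc
    match l with
    | none => exact Guard.neverReads_code hg trivial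
    | some (.inl l) => exact ihp hp hex l
    | some (.inr l) => exact ihq hq hex l
  | loop g p ih =>
    intro a b emb ex hc hex l
    obtain ⟨a₁, b₁, hg, hp, -⟩ := credit_loop_eq_some.1 hc
    match l with
    | none => exact Guard.neverReads_code hg hex
    | some l => exact ih hp (by trivial) l
  | seq p q ihp ihq =>
    intro a b emb ex hc hex l
    obtain ⟨b₁, hp, hq⟩ := credit_seq_eq_some.1 hc
    match l with
    | .inl l => exact ihp hp (by trivial) l
    | .inr l => exact ihq hq hex l

section Simulation

variable [DecidableEq K] [Fintype K] {Λ : Type}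

/-- The weight of the contents of the stacks. -/
def weight (w : K → ℕ) (S : ∀ k, List (Γ k)) : ℕ := ∑ k, w k * (S k).length

theorem weight_update (w : K → ℕ) (S : ∀ k, List (Γ k)) (k : K) (l : List (Γ k)) :
    weight w (Function.update S k l) + w k * (S k).length = weight w S + w k * l.length := by
  have hrest : ∑ j ∈ Finset.univ.erase k, w j * (Function.update S k l j).length =
      ∑ j ∈ Finset.univ.erase k, w j * (S j).length :=
    Finset.sum_congr rfl fun j hj => by rw [Function.update_of_ne (Finset.ne_of_mem_erase hj)]
  unfold weight
  rw [← Finset.add_sum_erase _ _ (Finset.mem_univ k),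
    ← Finset.add_sum_erase _ (fun j => w j * (S j).length) (Finset.mem_univ k),
    hrest, Function.update_self]
  ring

theorem weight_push (w : K → ℕ) (S : ∀ k, List (Γ k)) (k : K) (x : Γ k) :
    weight w (Function.update S k (x :: S k)) = weight w S + w k := by
  have := weight_update w S k (x :: S k)
  simp only [List.length_cons, Nat.mul_add, mul_one] at this
  omega

theorem Guard.weight_add_credit {w : K → ℕ} {out : K} {g : Guard Γ σ} {v v₁ : σ}
    {S S₁ : ∀ k, List (Γ k)} {a b : ℕ} (h : g.eval v S = some (v₁, S₁))
    (hc : g.credit w out a = some b) : weight w S₁ + b = weight w S + a := by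
  cases g with
  | test c =>
    simp only [eval, Option.ite_none_right_eq_some, Option.some.injEq, Prod.mk.injEq] at h
    simp only [credit, Option.some.injEq] at hc
    rw [← h.2.2, hc]
  | pop k f =>
    simp only [credit, Option.ite_none_left_eq_some, Option.some.injEq] at hc
    cases hS : S k with
    | nil => simp [eval, hS] at h
    | cons x l =>
      simp only [eval, hS, Option.some.injEq, Prod.mk.injEq] at h
      have := weight_update w S k l
      simp only [h.2, hS, List.length_cons, Nat.mul_add, mul_one] at this
      omega

/-- A finite computation in which all the configurations except possibly the last have weight at
most `N`. -/
inductive LightPath (w : K → ℕ) (N : ℕ) (M : Λ → Code Γ σ Λ) :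
    Turing.TM2.Cfg Γ Λ (Bool × σ) → Turing.TM2.Cfg Γ Λ (Bool × σ) → Prop
  | refl (c) : LightPath w N M c c
  | step {l v S c} : weight w S ≤ N → LightPath w N M (Turing.TM2.stepAux (M l) v S) c →
      LightPath w N M ⟨some l, v, S⟩ c

namespace LightPath

variable {w : K → ℕ} {N : ℕ} {M : Λ → Code Γ σ Λ} {c c' d : Turing.TM2.Cfg Γ Λ (Bool × σ)}

theorem trans (h : LightPath w N M c c') (h' : LightPath w N M c' d) : LightPath w N M c d := by
  induction h with
  | refl c => exact h'
  | step hw _ ih => exact .step hw (ih h')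

theorem reaches (h : LightPath w N M c c') : Turing.TM2.Reaches M c c' := by
  induction h with
  | refl c => exact .refl
  | step _ _ ih => exact .head (by simp) ih

theorem weight_le (h : LightPath w N M c c') (hl : c'.l = none) (hw : weight w c'.stk ≤ N)
    (hd : Turing.TM2.Reaches M c d) : weight w d.stk ≤ N := by
  induction h with
  | refl c =>
    rcases hd.cases_head with rfl | ⟨x, hx, -⟩
    · exact hw
    · obtain ⟨l, v, S⟩ := c
      cases hl
      simp at hx
  | step hs _ ih =>
    rcases hd.cases_head with rfl | ⟨x, hx, hd⟩
    · exact hs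
    · simp only [Turing.TM2.step, Option.mem_def, Option.some.injEq] at hx
      subst hx
      exact ih hl hw hd

end LightPath

/-- Wherever `p` occurs in the machine `M` and whatever follows it there, `M` performs the
execution of `p` from `v, S` to `v', S'`, and weight plus credit stay at most `N`. -/
def Simulates (w : K → ℕ) (out : K) (N : ℕ) (M : Λ → Code Γ σ Λ) (p : Prog Γ σ)
    (v : σ) (S : ∀ k, List (Γ k)) (v' : σ) (S' : ∀ k, List (Γ k)) : Prop :=
  ∀ ⦃a b : ℕ⦄ ⦃emb : p.Lab → Λ⦄ ⦃ex : Code Γ σ Λ⦄,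
    (∀ l, M (emb l) = p.code emb ex l) → p.credit w out a = some b → weight w S + a ≤ N →
    weight w S' + b ≤ N ∧ ∀ β, ∃ β',
      LightPath w N M ⟨some (emb p.entry), (β, v), S⟩ (Turing.TM2.stepAux ex (β', v') S')

section Simulates

variable {w : K → ℕ} {out : K} {N : ℕ} {M : Λ → Code Γ σ Λ} {g : Guard Γ σ} {p q : Prog Γ σ}
  {v v₁ v₂ v' : σ} {S S₁ S₂ S' : ∀ k, List (Γ k)}

theorem simulates_load (f : σ → σ) : Simulates w out N M (load f) v S (f v) S := by
  intro a b emb ex hM hc hw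
  simp only [credit, Option.some.injEq] at hc
  subst hc
  refine ⟨hw, fun β => ⟨β, .step (by omega) ?_⟩⟩
  rw [hM]
  exact .refl _

theorem simulates_push (k : K) (f : σ → Γ k) :
    Simulates w out N M (push k f) v S v (Function.update S k (f v :: S k)) := by
  intro a b emb ex hM hc hw
  simp only [credit, Option.ite_none_right_eq_some, Option.some.injEq] at hc
  refine ⟨by rw [weight_push]; omega, fun β => ⟨β, .step (by omega) ?_⟩⟩
  rw [hM]
  exact .refl _

theorem Simulates.ite_some (hg : g.eval v S = some (v₁, S₁))
    (hp : Simulates w out N M p v₁ S₁ v' S') : Simulates w out N M (ite g p q) v S v' S' := by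
  intro a b emb ex hM hc hw
  obtain ⟨a₁, b₁, b₂, hga, hpa, -, rfl⟩ := credit_ite_eq_some.1 hc
  have hw₁ := Guard.weight_add_credit hg hga
  obtain ⟨hb, hpath⟩ := hp (fun l => hM (some (.inl l))) hpa (by omega)
  refine ⟨by omega, fun β => ?_⟩
  obtain ⟨β₁, hβ₁⟩ := Guard.stepAux_code_of_eval_eq_some hg β
  obtain ⟨β', hβ'⟩ := hpath β₁
  refine ⟨β', .step (by omega) ?_⟩
  rw [hM]
  exact hβ₁ ▸ hβ'

theorem Simulates.ite_none (hg : g.eval v S = none) (hq : Simulates w out N M q v S v' S') :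
    Simulates w out N M (ite g p q) v S v' S' := by
  intro a b emb ex hM hc hw
  obtain ⟨a₁, b₁, b₂, -, -, hqa, rfl⟩ := credit_ite_eq_some.1 hc
  obtain ⟨hb, hpath⟩ := hq (fun l => hM (some (.inr l))) hqa hw
  refine ⟨by omega, fun β => ?_⟩
  obtain ⟨β₁, hβ₁⟩ := Guard.stepAux_code_of_eval_eq_none hg β
  obtain ⟨β', hβ'⟩ := hpath β₁
  refine ⟨β', .step (by omega) ?_⟩
  rw [hM]
  exact hβ₁ ▸ hβ'

theorem Simulates.loop_some (hg : g.eval v S = some (v₁, S₁))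
    (hp : Simulates w out N M p v₁ S₁ v₂ S₂) (hl : Simulates w out N M (loop g p) v₂ S₂ v' S') :
    Simulates w out N M (loop g p) v S v' S' := by
  intro a b emb ex hM hc hw
  obtain ⟨a₁, b₁, hga, hpa, hab, -⟩ := credit_loop_eq_some.1 hc
  have hw₁ := Guard.weight_add_credit hg hga
  obtain ⟨hb₁, hpath₁⟩ := hp (fun l => hM (some l)) hpa (by omega)
  obtain ⟨hb, hpath⟩ := hl hM hc (by omega)
  refine ⟨hb, fun β => ?_⟩
  obtain ⟨β₁, hβ₁⟩ := Guard.stepAux_code_of_eval_eq_some hg β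
  obtain ⟨β₂, hβ₂⟩ := hpath₁ β₁
  obtain ⟨β', hβ'⟩ := hpath β₂
  refine ⟨β', .step (by omega) ?_⟩
  rw [hM]
  exact (hβ₁ ▸ hβ₂).trans hβ'

theorem simulates_loop_none (hg : g.eval v S = none) :
    Simulates w out N M (loop g p) v S v S := by
  intro a b emb ex hM hc hw
  obtain ⟨a₁, b₁, -, -, -, rfl⟩ := credit_loop_eq_some.1 hc
  refine ⟨hw, fun β => ?_⟩
  obtain ⟨β', hβ'⟩ := Guard.stepAux_code_of_eval_eq_none hg β
  refine ⟨β', .step (by omega) ?_⟩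
  rw [hM]
  exact hβ' ▸ .refl _

theorem Simulates.seq (hp : Simulates w out N M p v S v₁ S₁)
    (hq : Simulates w out N M q v₁ S₁ v' S') : Simulates w out N M (seq p q) v S v' S' := by
  intro a b emb ex hM hc hw
  obtain ⟨b₁, hpa, hqa⟩ := credit_seq_eq_some.1 hc
  obtain ⟨hb₁, hpath₁⟩ := hp (fun l => hM (.inl l)) hpa hw
  obtain ⟨hb, hpath⟩ := hq (fun l => hM (.inr l)) hqa hb₁
  refine ⟨hb, fun β => ?_⟩
  obtain ⟨β₁, hβ₁⟩ := hpath₁ β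
  obtain ⟨β', hβ'⟩ := hpath β₁
  exact ⟨β', hβ₁.trans hβ'⟩

theorem Exec.simulates (h : Exec p v S v' S') : Simulates w out N M p v S v' S' := by
  induction h with
  | load f v S => exact simulates_load f
  | push k f v S => exact simulates_push k f
  | ite_some hg _ ih => exact .ite_some hg ih
  | ite_none hg _ ih => exact .ite_none hg ih
  | loop_some hg _ _ ih₁ ih₂ => exact .loop_some hg ih₁ ih₂
  | loop_none hg => exact simulates_loop_none hg
  | seq _ _ ih₁ ih₂ => exact .seq ih₁ ih₂

end Simulates

end Simulation

theorem initList_eq_update (tm : Turing.FinTM2) (s : List (tm.Γ tm.k₀)) :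
    Turing.initList tm s =
      ⟨some tm.main, tm.initialState, Function.update (fun _ => []) tm.k₀ s⟩ := by
  unfold Turing.initList
  congr 1
  funext k
  by_cases hk : k = tm.k₀
  · subst hk
    rw [Function.update_self]
    exact dif_pos rfl
  · rw [Function.update_of_ne hk]
    exact dif_neg hk

section Transducer

variable [DecidableEq K] [Fintype K] [Fintype σ] [Inhabited σ] [∀ k, Finite (Γ k)] {I O : Type}

/-- The transducer that runs a program. -/
noncomputable def transducer (p : Prog Γ σ) (w : K → ℕ) (inp out : K) (hne : inp ≠ out)
    (eI : Γ inp ≃ I) (eO : Γ out ≃ O) {a b : ℕ} (hp : p.credit w out a = some b) :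
    Transducer I O where
  tm :=
    { K := K
      k₀ := inp
      k₁ := out
      Γ := Γ
      Λ := p.Lab
      main := p.entry
      ΛFin := Fintype.ofFinite _
      σ := Bool × σ
      initialState := (false, default)
      Γk₀Fin := Fintype.ofFinite _
      m := p.code id .halt }
  inputAlphabet := eI
  outputAlphabet := eO
  finite_alphabet := fun k => inferInstanceAs (Finite (Γ k))
  input_ne_output := hne
  write_only := fun l => p.neverReads_code (ex := .halt) hp (by trivial) l

variable {p : Prog Γ σ} {w : K → ℕ} {inp out : K} {hne : inp ≠ out} {eI : Γ inp ≃ I}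
  {eO : Γ out ≃ O} {a b : ℕ} {hp : p.credit w out a = some b}

theorem space_transducer_le_weight (hpos : ∀ k, k ≠ out → 1 ≤ w k)
    (c : Turing.TM2.Cfg Γ p.Lab (Bool × σ)) :
    (p.transducer w inp out hne eI eO hp).space c ≤ weight w c.stk :=
  calc ∑ k with k ≠ out, (c.stk k).length
    _ ≤ ∑ k with k ≠ out, w k * (c.stk k).length := Finset.sum_le_sum fun k hk =>
        Nat.le_mul_of_pos_left _ (hpos k (Finset.mem_filter.1 hk).2)
    _ ≤ ∑ k, w k * (c.stk k).length :=
        Finset.sum_le_sum_of_subset (Finset.filter_subset _ _)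

theorem transducer_outputsInSpace (hpos : ∀ k, k ≠ out → 1 ≤ w k) {x : List I} {y : List O}
    {v' : σ} {S' : ∀ k, List (Γ k)}
    (hex : Exec p default (Function.update (fun _ => []) inp (x.map eI.symm)) v' S')
    (hy : ((S' out).map eO).reverse = y) :
    (p.transducer w inp out hne eI eO hp).OutputsInSpace x y (w inp * x.length + a) := by
  have hw : weight w (Function.update (fun k => ([] : List (Γ k))) inp (x.map eI.symm)) =
      w inp * x.length := by
    simpa [weight] using weight_update w (fun k => ([] : List (Γ k))) inp (x.map eI.symm)
  obtain ⟨hb, hpath⟩ := hex.simulates (M := p.code id .halt) (emb := id) (ex := .halt)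
    (N := w inp * x.length + a) (fun l => rfl) hp (by rw [hw])
  obtain ⟨β, hβ⟩ := hpath false
  refine ⟨⟨⟨none, (β, v'), S'⟩, ?_, rfl, hy⟩, fun c hc => ?_⟩
  · rw [Transducer.Visits, initList_eq_update]
    exact hβ.reaches
  · rw [Transducer.Visits, initList_eq_update] at hc
    exact (space_transducer_le_weight (Γ := Γ) hpos c).trans
      (hβ.weight_le rfl ((Nat.le_add_right _ b).trans hb) hc)

end Transducer

end Prog

/-! ### Stacks, registers and rules for verifying programs -/

namespace IPCANTWriter

instance : Fintype Token where
  elems := {.zero, .one, .sep, .lpar, .rpar, .st, .down, .top, .bot, .and, .or, .eps, .letter,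
    .inc, .dec, .transf}
  complete := by intro x; cases x <;> simp

/-- The sets of states of the register automaton that the machine keeps: one used for listing
states and counters, the source and the target of a transfer, those after a round, and the
singleton of the initial state. -/
inductive Track : Type
  | listed | source | target | after | init
  deriving DecidableEq

instance : Fintype Track where
  elems := {.listed, .source, .target, .after, .init}
  complete := by intro x; cases x <;> simp

/-- The sequences that are traversed repeatedly: there is a cell for each state of the register
automaton, and there is a symbol for each letter. -/
inductive Band : Type
  | cells | letters
  deriving DecidableEq

instance : Fintype Band where
  elems := {.cells, .letters}
  complete := by intro x; cases x <;> simp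

/-- The symbols of bands.  A cell stores the membership of its state in each of the sets, and the
symbol for a letter is the result of comparing it to the current letter. -/
abbrev Band.Sym : Band → Type
  | cells => Track → Bool
  | letters => Ordering

/-- The stacks.  During a traversal, the symbols of a band that have been passed are on its
back. -/
inductive Stack : Type
  | inp | out | table | tableR | vals | spare
  | front (b : Band)
  | back (b : Band)
  deriving DecidableEq

instance : Fintype Stack where
  elems := {.inp, .out, .table, .tableR, .vals, .spare, .front .cells, .front .letters,
    .back .cells, .back .letters}
  complete := by rintro (_ | _ | _ | _ | _ | _ | (_ | _) | (_ | _)) <;> simp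

abbrev Sym : Stack → Type
  | .inp | .out | .table | .tableR => Token
  | .vals => Bool
  | .spare => Unit
  | .front b | .back b => b.Sym

instance : Finite Ordering :=
  Finite.of_surjective ![Ordering.lt, .eq, .gt] fun o => by cases o <;> decide

instance : ∀ k, Finite (Sym k)
  | .inp | .out | .table | .tableR => inferInstanceAs (Finite Token)
  | .vals => inferInstanceAs (Finite Bool)
  | .spare => inferInstanceAs (Finite Unit)
  | .front .cells | .back .cells => inferInstanceAs (Finite (Track → Bool))
  | .front .letters | .back .letters => inferInstanceAs (Finite Ordering)

/-- The internal state. -/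
structure Reg : Type where
  tok : Token := .sep
  cell : Track → Bool := fun _ => false
  ord : Ordering := .lt
  bit : Bool := false
  flag : Bool := false
  carry : Bool := false

namespace Reg

instance : Inhabited Reg := ⟨{}⟩

noncomputable instance : Fintype Reg :=
  @Fintype.ofFinite _ <|
    Finite.of_injective (fun r : Reg => (r.tok, r.cell, r.ord, r.bit, r.flag, r.carry)) <| by
      rintro ⟨⟩ ⟨⟩ h
      simpa using h

def sym (v : Reg) : (b : Band) → b.Sym
  | .cells => v.cell
  | .letters => v.ord

def setSym (v : Reg) : (b : Band) → b.Sym → Reg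
  | .cells, x => { v with cell := x }
  | .letters, x => { v with ord := x }

theorem sym_setSym (v : Reg) (b : Band) (x : b.Sym) : (v.setSym b x).sym b = x := by
  cases b <;> rfl

theorem setSym_sym (v : Reg) (b : Band) : v.setSym b (v.sym b) = v := by cases b <;> rfl

theorem setSym_setSym (v : Reg) (b : Band) (x y : b.Sym) :
    (v.setSym b x).setSym b y = v.setSym b y := by
  cases b <;> rfl

end Reg

/-- The contents of the stacks. -/
structure Tapes : Type where
  inp : List Token := []
  out : List Token := []
  table : List Token := []
  tableR : List Token := []
  vals : List Bool := []
  spare : List Unit := []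
  cells : List (Track → Bool) := []
  cellsR : List (Track → Bool) := []
  letters : List Ordering := []
  lettersR : List Ordering := []

namespace Tapes

def get (t : Tapes) : (k : Stack) → List (Sym k)
  | .inp => t.inp
  | .out => t.out
  | .table => t.table
  | .tableR => t.tableR
  | .vals => t.vals
  | .spare => t.spare
  | .front .cells => t.cells
  | .back .cells => t.cellsR
  | .front .letters => t.letters
  | .back .letters => t.lettersR

def put (t : Tapes) : (k : Stack) → List (Sym k) → Tapes
  | .inp, l => { t with inp := l }
  | .out, l => { t with out := l }
  | .table, l => { t with table := l }
  | .tableR, l => { t with tableR := l }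
  | .vals, l => { t with vals := l }
  | .spare, l => { t with spare := l }
  | .front .cells, l => { t with cells := l }
  | .back .cells, l => { t with cellsR := l }
  | .front .letters, l => { t with letters := l }
  | .back .letters, l => { t with lettersR := l }

theorem get_put_self (t : Tapes) (k : Stack) (l : List (Sym k)) : (t.put k l).get k = l := by
  rcases k with _ | _ | _ | _ | _ | _ | (_ | _) | (_ | _) <;> rfl

theorem put_put_self (t : Tapes) (k : Stack) (l l' : List (Sym k)) :
    (t.put k l).put k l' = t.put k l' := by
  rcases k with _ | _ | _ | _ | _ | _ | (_ | _) | (_ | _) <;> rfl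

theorem get_put (t : Tapes) (k : Stack) (l : List (Sym k)) :
    (t.put k l).get = Function.update t.get k l := by
  funext j
  by_cases h : j = k
  · subst h
    rw [Function.update_self, get_put_self]
  · rw [Function.update_of_ne h]
    rcases k with _ | _ | _ | _ | _ | _ | (_ | _) | (_ | _) <;>
      rcases j with _ | _ | _ | _ | _ | _ | (_ | _) | (_ | _) <;>
      first | rfl | exact absurd rfl h

/-- Change the contents of a band, `c` being in front and `r` behind. -/
def withBand (t : Tapes) (b : Band) (c r : List b.Sym) : Tapes :=
  (t.put (.back b) r).put (.front b) c

end Tapes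

/-- Programs over these stacks and registers. -/
abbrev P : Type := Prog Sym Reg

/-- The weakest precondition: `p` terminates in a state that satisfies `Q`. -/
def wp (p : P) (Q : Reg → Tapes → Prop) (v : Reg) (t : Tapes) : Prop :=
  ∃ v' t', Prog.Exec p v t.get v' t'.get ∧ Q v' t'

section Rules

variable {p q : P} {Q : Reg → Tapes → Prop} {v : Reg} {t : Tapes} {k : Stack}

theorem wp_mono {Q' : Reg → Tapes → Prop} (h : wp p Q v t) (hQ : ∀ v t, Q v t → Q' v t) :
    wp p Q' v t := by
  obtain ⟨v', t', he, hq⟩ := h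
  exact ⟨v', t', he, hQ _ _ hq⟩

theorem wp_seq (h : wp p (wp q Q) v t) : wp (.seq p q) Q v t := by
  obtain ⟨v₁, t₁, h₁, v', t', h₂, hq⟩ := h
  exact ⟨v', t', .seq h₁ h₂, hq⟩

theorem wp_load {f : Reg → Reg} (h : Q (f v) t) : wp (.load f) Q v t :=
  ⟨_, _, .load .., h⟩

theorem wp_push {f : Reg → Sym k} (h : Q v (t.put k (f v :: t.get k))) :
    wp (.push k f) Q v t := by
  refine ⟨_, _, ?_, h⟩
  rw [Tapes.get_put]
  exact .push ..

theorem eval_test_of_true {c : Reg → Bool} (hc : c v = true) :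
    (Prog.Guard.test (Γ := Sym) c).eval v t.get = some (v, t.get) := by
  simp [Prog.Guard.eval, hc]

theorem eval_test_of_false {c : Reg → Bool} (hc : c v = false) :
    (Prog.Guard.test (Γ := Sym) c).eval v t.get = none := by
  simp [Prog.Guard.eval, hc]

theorem eval_pop_of_cons {f : Reg → Sym k → Reg} {x : Sym k} {l : List (Sym k)}
    (hk : t.get k = x :: l) :
    (Prog.Guard.pop k f).eval v t.get = some (f v x, (t.put k l).get) := by
  simp [Prog.Guard.eval, hk, Tapes.get_put]

theorem eval_pop_of_nil {f : Reg → Sym k → Reg} (hk : t.get k = []) :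
    (Prog.Guard.pop k f).eval v t.get = none := by
  simp [Prog.Guard.eval, hk]

theorem wp_ite_some {g : Prog.Guard Sym Reg} {v₁ : Reg} {t₁ : Tapes}
    (hg : g.eval v t.get = some (v₁, t₁.get)) (h : wp p Q v₁ t₁) : wp (.ite g p q) Q v t := by
  obtain ⟨v', t', he, hq⟩ := h
  exact ⟨v', t', .ite_some hg he, hq⟩

theorem wp_ite_none {g : Prog.Guard Sym Reg} (hg : g.eval v t.get = none) (h : wp q Q v t) :
    wp (.ite g p q) Q v t := by
  obtain ⟨v', t', he, hq⟩ := h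
  exact ⟨v', t', .ite_none hg he, hq⟩

theorem wp_loop_some {g : Prog.Guard Sym Reg} {v₁ : Reg} {t₁ : Tapes}
    (hg : g.eval v t.get = some (v₁, t₁.get)) (h : wp p (wp (.loop g p) Q) v₁ t₁) :
    wp (.loop g p) Q v t := by
  obtain ⟨v₂, t₂, h₁, v', t', h₂, hq⟩ := h
  exact ⟨v', t', .loop_some hg h₁ h₂, hq⟩

theorem wp_loop_none {g : Prog.Guard Sym Reg} (hg : g.eval v t.get = none) (h : Q v t) :
    wp (.loop g p) Q v t :=
  ⟨v, t, .loop_none hg, h⟩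

theorem wp_drain {f : Reg → Sym k → Reg} {l : List (Sym k)} {st : ℕ → Tapes}
    {J : ℕ → Reg → Prop} (h0 : J 0 v)
    (step : ∀ i (hi : i < l.length) v, J i v →
      wp p (fun v' t' => J (i + 1) v' ∧ t' = (st (i + 1)).put k (l.drop (i + 1)))
        (f v l[i]) ((st i).put k (l.drop (i + 1)))) :
    wp (.loop (.pop k f) p) (fun v' t' => J l.length v' ∧ t' = (st l.length).put k []) v
      ((st 0).put k l) := by
  suffices H : ∀ m i, i + m = l.length → ∀ v, J i v →
      wp (.loop (.pop k f) p) (fun v' t' => J l.length v' ∧ t' = (st l.length).put k []) v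
        ((st i).put k (l.drop i)) from H l.length 0 (Nat.zero_add _) v h0
  intro m
  induction m with
  | zero =>
    rintro i rfl v hv
    rw [List.drop_length]
    exact wp_loop_none (eval_pop_of_nil (Tapes.get_put_self ..)) ⟨hv, rfl⟩
  | succ m ih =>
    intro i hi v hv
    rw [List.drop_eq_getElem_cons (by omega)]
    refine wp_loop_some (eval_pop_of_cons (Tapes.get_put_self ..)) ?_
    rw [Tapes.put_put_self]
    refine wp_mono (step i (by omega) v hv) ?_
    rintro v' _ ⟨hv', rfl⟩
    exact ih (i + 1) (by omega) v' hv'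

end Rules

/-- Sequential composition of a list of programs. -/
def block : List P → P
  | [] => .load id
  | p :: ps => .seq p (block ps)

section Block

variable {p : P} {ps : List P} {Q : Reg → Tapes → Prop} {v : Reg} {t : Tapes}

theorem wp_block_cons (h : wp p (wp (block ps) Q) v t) : wp (block (p :: ps)) Q v t :=
  wp_seq h

theorem wp_block_nil (h : Q v t) : wp (block []) Q v t :=
  wp_load h

end Block

/-! ### Traversing bands -/

/-- Return to the first symbol of a band. -/
def rewind (b : Band) : P :=
  .loop (.pop (.back b) (·.setSym b)) (.push (.front b) (·.sym b))

/-- Run `p` for each symbol of a band, putting the symbol back as changed by `p`. -/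
def sweep (b : Band) (p : P) : P :=
  block [.loop (.pop (.front b) (·.setSym b)) (block [p, .push (.back b) (·.sym b)]), rewind b]

section Sweep

variable {b : Band} {p : P} {Q : Reg → Tapes → Prop} {v : Reg} {n : ℕ} {x y : ℕ → b.Sym}

theorem wp_rewind {t : Tapes} {c r : List b.Sym}
    (h : ∀ z, Q (v.setSym b z) (t.withBand b (r.reverse ++ c) [])) :
    wp (rewind b) Q v (t.withBand b c r) := by
  induction r generalizing c v with
  | nil =>
    refine wp_loop_none (eval_pop_of_nil (by cases b <;> rfl)) ?_
    simpa [Reg.setSym_sym] using h (v.sym b)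
  | cons z r ih =>
    refine wp_loop_some (eval_pop_of_cons (x := z) (l := r) (by cases b <;> rfl)) (wp_push ?_)
    have hput : ((t.withBand b c (z :: r)).put (.back b) r).put (.front b)
        ((v.setSym b z).sym b :: ((t.withBand b c (z :: r)).put (.back b) r).get (.front b)) =
          t.withBand b (z :: c) r := by
      rw [Reg.sym_setSym]
      cases b <;> rfl
    rw [hput]
    refine ih fun z' => ?_
    simpa [Reg.setSym_setSym] using h z'

theorem wp_sweep {st : ℕ → Tapes} {J : ℕ → Reg → Prop} (h0 : J 0 v)
    (hset : ∀ i v z, J i v → J i (v.setSym b z))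
    (step : ∀ i < n, ∀ v c r, J i v → v.sym b = x i →
      wp p (fun v' t' => J (i + 1) v' ∧ v'.sym b = y i ∧ t' = (st (i + 1)).withBand b c r) v
        ((st i).withBand b c r)) :
    wp (sweep b p) (fun v' t' => J n v' ∧ t' = (st n).withBand b ((List.range n).map y) []) v
      ((st 0).withBand b ((List.range n).map x) []) := by
  refine wp_block_cons (wp_mono (wp_drain (k := .front b) (l := (List.range n).map x)
    (st := fun i => (st i).put (.back b) ((List.range i).map y).reverse) h0 ?_) ?_)
  · intro i hi v hv
    simp only [List.length_map, List.length_range] at hi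
    refine wp_block_cons (wp_mono (step i hi _ _ _ (hset i v _ hv) ?_) ?_)
    · simp [Reg.sym_setSym]
    · rintro v' _ ⟨hv', hy, rfl⟩
      refine wp_block_cons (wp_push (wp_block_nil ⟨hv', ?_⟩))
      rw [hy, List.range_succ, List.map_append, List.reverse_append]
      cases b <;> rfl
  · rintro v' _ ⟨hv', rfl⟩
    simp only [List.length_map, List.length_range] at hv' ⊢
    refine wp_block_cons (wp_rewind fun z => wp_block_nil ⟨hset n v' z hv', ?_⟩)
    simp

end Sweep

/-! ### Programs that only write -/

/-- `p` writes `w` and changes no other stack of `t`. -/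
def Emits (p : P) (t : Tapes) (w : List Token) : Prop :=
  ∀ o v, wp p (fun _ t' => t' = { t with out := w.reverse ++ o }) v { t with out := o }

def emit (x : Token) : P := .push .out fun _ => x

section Emits

variable {p : P} {t : Tapes} {w w' : List Token}

theorem Emits.block_nil : Emits (block []) t [] :=
  fun _ _ => wp_block_nil rfl

theorem Emits.block_cons {ps : List P} (h : Emits p t w) (h' : Emits (block ps) t w') :
    Emits (block (p :: ps)) t (w ++ w') := by
  intro o v
  refine wp_block_cons (wp_mono (h o v) ?_)
  rintro v' _ rfl
  simpa using h' (w.reverse ++ o) v'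

theorem emits_emit (x : Token) : Emits (emit x) t [x] :=
  fun _ _ => wp_push rfl

theorem Emits.wp {Q : Reg → Tapes → Prop} {o : List Token} {v : Reg}
    (h : Emits p t w) (hQ : ∀ v', Q v' { t with out := w.reverse ++ o }) :
    wp p Q v { t with out := o } :=
  wp_mono (h o v) fun v' _ ht' => ht' ▸ hQ v'

theorem emits_sweep {b : Band} {n : ℕ} {x : ℕ → b.Sym} {g : ℕ → List Token}
    (h : ∀ i < n, ∀ v t, v.sym b = x i → wp p (fun v' t' =>
      v'.sym b = x i ∧ t' = { t with out := (g i).reverse ++ t.out }) v t) :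
    Emits (sweep b p) (t.withBand b ((List.range n).map x) []) ((List.range n).flatMap g) := by
  intro o v
  have hst : ∀ o c r, ({ t with out := o } : Tapes).withBand b c r =
      { t.withBand b c r with out := o } := by
    cases b <;> exact fun _ _ _ => rfl
  rw [← hst, ← hst]
  refine wp_mono (wp_sweep (J := fun _ _ => True) (x := x) (y := x)
    (st := fun i => { t with out := ((List.range i).flatMap g).reverse ++ o }) trivial
    (fun _ _ _ _ => trivial) ?_) fun _ _ ht' => ht'.2
  intro i hi v c r _ hv
  refine wp_mono (h i hi v _ hv) ?_
  rintro v' _ ⟨hv', rfl⟩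
  refine ⟨trivial, hv', ?_⟩
  cases b <;> simp [Tapes.withBand, Tapes.put, List.range_succ]

end Emits

/-- The symbol for a bit. -/
def bitTok (b : Bool) : Token := if b then .one else .zero

/-- Write the bits of a set of states. -/
def emitTrack (i : Track) : P := sweep .cells (.push .out fun v => bitTok (v.cell i))

/-- Write a stroke for each state. -/
def emitStateCount : P := sweep .cells (emit .one)

/-- Write a stroke for each letter before the current one. -/
def emitLetter : P :=
  sweep .letters (.ite (.test fun v => v.ord = .lt) (emit .one) (block []))

end IPCANTWriter

/-- The truth value of a formula. -/
def PosBool.eval {Q : Type} (P P' : Q → Bool) : PosBool Q → Bool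
  | state q => P q
  | down q => P' q
  | top => true
  | bot => false
  | and φ ψ => φ.eval P P' && ψ.eval P P'
  | or φ ψ => φ.eval P P' || ψ.eval P P'

theorem PosBool.eval_iff {Q : Type} (P P' : Q → Bool) (φ : PosBool Q) :
    φ.eval P P' = true ↔ φ.Sat {q | P q = true} {q | P' q = true} := by
  induction φ with
  | state q => rfl
  | down q => rfl
  | top => simp [eval, Sat]
  | bot => simp [eval, Sat]
  | and φ ψ ihφ ihψ => simp [eval, Sat, ihφ, ihψ]
  | or φ ψ ihφ ihψ => simp [eval, Sat, ihφ, ihψ]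

namespace IPCANTWriter

/-! ### Evaluating the transition table -/

/-- Evaluation of formulae in prefix notation, symbol by symbol from the right.  The state consists
of a number, which is that of a state of the register automaton after its strokes have been read,
and the stack of the values of subformulae.  Tracks `i` and `j` of the cells `cs` interpret the
states without and with `↓`. -/
def evalStep (cs : List (Track → Bool)) (i j : Track) : Token → ℕ × List Bool → ℕ × List Bool
  | .one, (m, l) => (m + 1, l)
  | .st, (m, l) => (0, (cs[m]?.map (· i)).toList ++ l)
  | .down, (m, l) => (0, (cs[m]?.map (· j)).toList ++ l)
  | .top, (m, l) => (m, true :: l)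
  | .bot, (m, l) => (m, false :: l)
  | .and, (m, x :: y :: l) => (m, (x && y) :: l)
  | .or, (m, x :: y :: l) => (m, (x || y) :: l)
  | _, s => s

section EvalStep

variable {cs : List (Track → Bool)} {i j : Track}

theorem foldr_evalStep_tally (m : ℕ) (l : List Bool) :
    (Token.tally m).foldr (evalStep cs i j) (0, l) = (m, l) := by
  suffices H : (List.replicate m Token.one).foldr (evalStep cs i j) (0, l) = (m, l) by
    simpa [Token.tally, evalStep] using H
  induction m with
  | zero => rfl
  | succ m ih => rw [List.replicate_succ, List.foldr_cons, ih, evalStep]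

theorem foldr_evalStep_encode {Q : Type} {num : Q → ℕ} {x : Q → Track → Bool}
    (hc : ∀ q, cs[num q]? = some (x q)) (φ : PosBool Q) (l : List Bool) :
    (φ.encode num).foldr (evalStep cs i j) (0, l) = (0, φ.eval (x · i) (x · j) :: l) := by
  induction φ generalizing l with
  | state q | down q =>
    simp [PosBool.encode, foldr_evalStep_tally, evalStep, hc, PosBool.eval]
  | top | bot => rfl
  | and φ ψ ihφ ihψ | or φ ψ ihφ ihψ =>
    simp [PosBool.encode, List.foldr_append, ihφ, ihψ, evalStep, PosBool.eval]

theorem foldr_evalStep_flatMap_encode {Q : Type} {num : Q → ℕ} {x : Q → Track → Bool}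
    (hc : ∀ q, cs[num q]? = some (x q)) (φs : List (PosBool Q)) :
    (φs.flatMap (·.encode num)).foldr (evalStep cs i j) (0, []) =
      (0, φs.map (·.eval (x · i) (x · j))) := by
  induction φs with
  | nil => rfl
  | cons φ φs ih =>
    rw [List.flatMap_cons, List.foldr_append, ih, foldr_evalStep_encode hc, List.map_cons]

theorem length_evalStep_le (y : Token) (s : ℕ × List Bool) :
    (evalStep cs i j y s).2.length ≤ s.2.length + 1 := by
  obtain ⟨m, l⟩ := s
  rcases y with _ | _ | _ | _ | _ | _ | _ | _ | _ | _ | _ | _ | _ | _ | _ | _ <;>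
    rcases l with _ | ⟨x, _ | ⟨y, l⟩⟩ <;>
      simp [evalStep] <;> cases cs[m]? <;> simp <;> omega

theorem length_foldl_evalStep_le (l : List Token) :
    (l.foldl (fun s y => evalStep cs i j y s) (0, [])).2.length ≤ l.length := by
  induction l using List.reverseRecOn with
  | nil => simp
  | append_singleton l y ih =>
    rw [List.foldl_concat, List.length_append]
    exact (length_evalStep_le ..).trans (Nat.succ_le_succ ih)

end EvalStep

/-- Run the program that is assigned to the symbol read. -/
def switch : List (Token × P) → P
  | [] => block []
  | (x, p) :: l => .ite (.test fun v => v.tok = x) p (switch l)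

/-- Pass a cell. -/
def advance : P :=
  .ite (.pop (.front .cells) (·.setSym .cells)) (.push (.back .cells) (·.cell)) (block [])

/-- Push a value. -/
def pushVal (f : Reg → Bool) : P :=
  .ite (.pop .spare fun v _ => v) (.push .vals f) (block [])

/-- Push the bit of the current cell on a track, and return to the first cell. -/
def readBit (i : Track) : P :=
  block [.ite (.pop (.front .cells) (·.setSym .cells))
    (block [.push (.front .cells) (·.cell), pushVal (·.cell i)]) (block []), rewind .cells]

/-- Replace the two topmost values by the result of a connective. -/
def connective (f : Bool → Bool → Bool) : P :=
  .ite (.pop .vals fun v x => { v with bit := x })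
    (.ite (.pop .vals fun v x => { v with bit := f v.bit x })
      (block [.push .vals (·.bit), .push .spare fun _ => ()]) (.push .vals (·.bit))) (block [])

/-- Perform `evalStep` for the symbol read. -/
def evalTok (i j : Track) : P :=
  switch [(.one, advance), (.st, readBit i), (.down, readBit j), (.top, pushVal fun _ => true),
    (.bot, pushVal fun _ => false), (.and, connective (· && ·)), (.or, connective (· || ·))]

/-- Compute the values of all the formulae in the table. -/
def computeVals (i j : Track) : P :=
  block [.loop (.pop .table fun v x => { v with tok := x })
      (block [.push .tableR (·.tok), evalTok i j]),
    .loop (.pop .tableR fun v x => { v with tok := x }) (.push .table (·.tok))]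

/-- Change the stack of values; `N` is the number of symbols that are available for it. -/
def Tapes.withVals (t : Tapes) (N : ℕ) (l : List Bool) : Tapes :=
  { t with vals := l, spare := List.replicate (N - l.length) () }

/-- The stacks when evaluation is in state `s`. -/
def Tapes.evaluating (t : Tapes) (N : ℕ) (cs : List (Track → Bool)) (s : ℕ × List Bool) : Tapes :=
  { t.withVals N s.2 with cells := cs.drop s.1, cellsR := (cs.take s.1).reverse }

section Evaluating

variable {Q : Reg → Tapes → Prop} {v : Reg} {t : Tapes} {N m : ℕ} {cs : List (Track → Bool)}
  {l : List Bool}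

theorem wp_switch {ps : List (Token × P)} {x : Token} (hx : v.tok = x)
    (h : wp ((ps.lookup x).getD (block [])) Q v t) : wp (switch ps) Q v t := by
  induction ps with
  | nil => exact h
  | cons y ps ih =>
    obtain ⟨y, p⟩ := y
    by_cases hxy : x = y
    · subst hxy
      rw [List.lookup_cons_self] at h
      exact wp_ite_some (eval_test_of_true (by simp [hx])) h
    · rw [List.lookup_cons, beq_eq_false_iff_ne.2 hxy] at h
      exact wp_ite_none (eval_test_of_false (by simp [hx, hxy])) (ih h)

theorem wp_advance (h : ∀ v', Q v' (t.evaluating N cs (m + 1, l))) :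
    wp advance Q v (t.evaluating N cs (m, l)) := by
  rcases lt_or_ge m cs.length with hm | hm
  · refine wp_ite_some (eval_pop_of_cons (List.drop_eq_getElem_cons hm)) (wp_push ?_)
    have hback : (cs.take (m + 1)).reverse = cs[m] :: (cs.take m).reverse := by
      rw [List.take_succ_eq_append_getElem hm, List.reverse_append]
      rfl
    have hs := h (v.setSym .cells cs[m])
    simp only [Tapes.evaluating, hback] at hs
    exact hs
  · refine wp_ite_none (eval_pop_of_nil (List.drop_eq_nil_of_le hm)) (wp_block_nil ?_)
    have hs := h v
    rw [Tapes.evaluating, List.drop_of_length_le (hm.trans (Nat.le_succ m)),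
      List.take_of_length_le (hm.trans (Nat.le_succ m))] at hs
    rwa [Tapes.evaluating, List.drop_of_length_le hm, List.take_of_length_le hm]

theorem wp_pushVal {f : Reg → Bool} (hl : l.length < N)
    (h : Q v (t.evaluating N cs (m, f v :: l))) :
    wp (pushVal f) Q v (t.evaluating N cs (m, l)) := by
  have hN : N - l.length = N - (l.length + 1) + 1 := by omega
  refine wp_ite_some (eval_pop_of_cons (x := ()) ?_) (wp_push h)
  change List.replicate (N - l.length) () = _
  rw [hN]
  rfl

theorem wp_rewind_evaluating (h : ∀ v', Q v' (t.evaluating N cs (0, l))) :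
    wp (rewind .cells) Q v (t.evaluating N cs (m, l)) := by
  refine wp_rewind (b := .cells) (t := t.evaluating N cs (m, l)) (c := cs.drop m)
    (r := (cs.take m).reverse) fun z => ?_
  rw [List.reverse_reverse, List.take_append_drop]
  exact h _

theorem wp_readBit {i : Track} (hl : l.length < N)
    (h : ∀ v', Q v' (t.evaluating N cs (0, (cs[m]?.map (· i)).toList ++ l))) :
    wp (readBit i) Q v (t.evaluating N cs (m, l)) := by
  rcases lt_or_ge m cs.length with hm | hm
  · rw [List.getElem?_eq_getElem hm] at h
    refine wp_block_cons <| wp_ite_some (eval_pop_of_cons (List.drop_eq_getElem_cons hm)) <|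
      wp_block_cons <| wp_push <| wp_block_cons ?_
    change wp _ _ _ { t.evaluating N cs (m, l) with cells := cs[m] :: cs.drop (m + 1) }
    rw [List.getElem_cons_drop]
    exact wp_pushVal hl <| wp_block_nil <| wp_block_cons <| wp_rewind_evaluating fun v' =>
      wp_block_nil (h v')
  · rw [List.getElem?_eq_none hm] at h
    exact wp_block_cons <| wp_ite_none (eval_pop_of_nil (List.drop_of_length_le hm)) <|
      wp_block_nil <| wp_block_cons <| wp_rewind_evaluating fun v' => wp_block_nil (h v')

theorem wp_connective {f : Bool → Bool → Bool}
    (h : ∀ v', Q v' (t.evaluating N cs (m, match l with | x :: y :: l => f x y :: l | l => l)))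
    (hl : l.length ≤ N) : wp (connective f) Q v (t.evaluating N cs (m, l)) := by
  match l with
  | [] => exact wp_ite_none (eval_pop_of_nil rfl) (wp_block_nil (h v))
  | [x] =>
    exact wp_ite_some (eval_pop_of_cons rfl) <| wp_ite_none (eval_pop_of_nil rfl) <| wp_push (h _)
  | x :: y :: l =>
    refine wp_ite_some (eval_pop_of_cons rfl) <| wp_ite_some (eval_pop_of_cons rfl) <|
      wp_block_cons <| wp_push <| wp_block_cons <| wp_push <| wp_block_nil ?_
    convert h _ using 2
    have hN : N - (l.length + 1) = N - (l.length + 1 + 1) + 1 := by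
      simp only [List.length_cons] at hl
      omega
    simp [Tapes.evaluating, Tapes.withVals, Tapes.put, Tapes.get, hN, List.replicate_succ]

theorem wp_evalTok {i j : Track} {x : Token} {s : ℕ × List Bool} (hx : v.tok = x)
    (hs : s.2.length < N) (h : ∀ v', Q v' (t.evaluating N cs (evalStep cs i j x s))) :
    wp (evalTok i j) Q v (t.evaluating N cs s) := by
  obtain ⟨m, l⟩ := s
  refine wp_switch hx ?_
  rcases x with _ | _ | _ | _ | _ | _ | _ | _ | _ | _ | _ | _ | _ | _ | _ | _
  case one => exact wp_advance h
  case st | down => exact wp_readBit hs h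
  case top | bot => exact wp_pushVal hs (h v)
  case and | or => rcases l with _ | ⟨x, _ | ⟨y, l⟩⟩ <;> exact wp_connective h hs.le
  all_goals exact wp_block_nil (h v)

theorem wp_computeVals {i j : Track} {u : List Token} (hu : u.length ≤ N) :
    wp (computeVals i j)
      (fun _ t' => t' = { t with table := u, tableR := [] }.evaluating N cs
        (u.foldl (fun s x => evalStep cs i j x s) (0, [])))
      v ({ t with table := u, tableR := [] }.evaluating N cs (0, [])) := by
  refine wp_block_cons (wp_mono (wp_drain (k := .table) (l := u) (J := fun _ _ => True)
    (st := fun m => { t with tableR := (u.take m).reverse }.evaluating N cs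
      ((u.take m).foldl (fun s x => evalStep cs i j x s) (0, []))) trivial ?_) ?_)
  · intro m hm v _
    refine wp_block_cons (wp_push (wp_block_cons ?_))
    refine wp_evalTok
      (t := { t with table := u.drop (m + 1), tableR := u[m] :: (u.take m).reverse })
      (x := u[m]) rfl ?_ fun v' => wp_block_nil ⟨trivial, ?_⟩
    · exact (length_foldl_evalStep_le _).trans_lt (by rw [List.length_take]; omega)
    · rw [List.take_succ_eq_append_getElem hm, List.foldl_concat, List.reverse_append]
      rfl
  · rintro v' _ ⟨-, rfl⟩
    rw [List.take_length]
    refine wp_block_cons (wp_mono (wp_drain (k := .tableR) (l := u.reverse) (J := fun _ _ => True)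
      (st := fun m => { t with table := (u.reverse.take m).reverse }.evaluating N cs
        (u.foldl (fun s x => evalStep cs i j x s) (0, []))) trivial ?_) ?_)
    · intro m hm v _
      refine wp_push ⟨trivial, ?_⟩
      rw [List.take_succ_eq_append_getElem hm, List.reverse_append]
      rfl
    · rintro v' _ ⟨-, rfl⟩
      rw [List.take_length, List.reverse_reverse]
      exact wp_block_nil rfl

end Evaluating

/-! ### Loops over subsets and letters -/

/-- The stacks between computations, when the table is `w`, the sets of states have the binary
expansions of `x` as their characteristic sequences, and the current letter is number `a`; at rest
that is the number of letters. -/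
def ready (n s : ℕ) (w : List Token) (x : Track → ℕ) (a : ℕ) : Tapes :=
  Tapes.withVals {
    table := w.reverse
    cells := (List.range n).map fun q i => (x i).testBit q
    letters := (List.range s).map fun b => compare b a } w.length []

/-- Add one to the binary counter on a track.  The flag `carry` tells whether it overflows. -/
def increment (i : Track) : P :=
  block [.load fun v => { v with carry := true }, sweep .cells <| .load fun v =>
    { v with cell := Function.update v.cell i (v.carry ^^ v.cell i), carry := v.carry && v.cell i }]

/-- Make the first letter the current one. -/
def firstLetter : P :=
  block [.load fun v => { v with carry := true }, sweep .letters <| .load fun v =>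
    { v with ord := if v.carry then .eq else .gt, carry := false }]

/-- Make the next letter the current one. -/
def nextLetter : P :=
  block [.load fun v => { v with carry := false }, sweep .letters <| .load fun v =>
    { v with
      ord := if v.carry then .eq else if v.ord = .eq then .lt else v.ord
      carry := decide (v.ord = .eq) }]

/-- Run `p`, and `next` after it, until `carry` is set. -/
def forLoop (start next p : P) : P :=
  block [start, .loop (.test fun v => !v.carry) (block [p, next])]

/-- Run `p` for each value of the counter on track `i`, which is initially zero. -/
def forSubsets (i : Track) (p : P) : P :=
  forLoop (.load fun v => { v with carry := false }) (increment i) p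

/-- Run `p` for each letter. -/
def forLetters (p : P) : P := forLoop firstLetter nextLetter p

/-- `p` writes nothing, changes the other stacks from `t` to `t'`, and sets `carry` to `b`. -/
def Advances (p : P) (t t' : Tapes) (b : Bool) : Prop :=
  ∀ o v, wp p (fun v' t'' => v'.carry = b ∧ t'' = { t' with out := o }) v { t with out := o }

theorem emits_forLoop {start next p : P} {t : Tapes} {N : ℕ} {st : ℕ → Tapes}
    {g : ℕ → List Token} (hstart : Advances start t (st 0) (decide (N = 0)))
    (hp : ∀ m < N, Emits p (st m) (g m))
    (hnext : ∀ m < N, Advances next (st m) (st (m + 1)) (decide (m + 1 = N))) (hN : st N = t) :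
    Emits (forLoop start next p) t ((List.range N).flatMap g) := by
  intro o v
  refine wp_block_cons (wp_mono (hstart o v) ?_)
  rintro v _ ⟨hv, rfl⟩
  refine wp_block_cons (wp_mono ?_ fun v' t' h => wp_block_nil h)
  suffices H : ∀ k m, m + k = N → ∀ v, v.carry = decide (m = N) →
      wp (.loop (.test fun v => !v.carry) (block [p, next]))
        (fun _ t' => t' = { t with out := ((List.range N).flatMap g).reverse ++ o }) v
        { st m with out := ((List.range m).flatMap g).reverse ++ o } from
    H N 0 (Nat.zero_add N) v (by simpa [eq_comm] using hv)
  intro k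
  induction k with
  | zero =>
    rintro m rfl v hv
    exact wp_loop_none (eval_test_of_false (by simp [hv])) (hN ▸ rfl)
  | succ k ih =>
    intro m hm v hv
    have hlt : m < N := by omega
    refine wp_loop_some (eval_test_of_true (by simp [hv, hlt.ne])) <| wp_block_cons <|
      (hp m hlt).wp fun v' => wp_block_cons <| wp_mono (hnext m hlt _ _) ?_
    rintro v' _ ⟨hv', rfl⟩
    refine wp_block_nil ?_
    simpa [List.range_succ] using ih (m + 1) (by omega) v' hv'

section Loops

variable {n s : ℕ} {w : List Token} {x : Track → ℕ} {a : ℕ} {p : P} {g : ℕ → List Token}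

theorem two_pow_succ_dvd_succ_iff (k q : ℕ) :
    2 ^ (q + 1) ∣ k + 1 ↔ 2 ^ q ∣ k + 1 ∧ k.testBit q = true := by
  rw [Nat.testBit_eq_decide_div_mod_eq, decide_eq_true_eq, pow_succ]
  refine ⟨fun h => ?_, fun ⟨h, _⟩ => ?_⟩
  · have hdvd := (Nat.dvd_mul_right ..).trans h
    rw [← Nat.dvd_div_iff_mul_dvd hdvd, Nat.succ_div_of_dvd hdvd] at h
    exact ⟨hdvd, by omega⟩
  · rw [← Nat.dvd_div_iff_mul_dvd h, Nat.succ_div_of_dvd h]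
    omega

theorem testBit_succ_eq_xor (k q : ℕ) :
    (k + 1).testBit q = (decide (2 ^ q ∣ k + 1) ^^ k.testBit q) := by
  rw [Nat.testBit_eq_decide_div_mod_eq, Nat.testBit_eq_decide_div_mod_eq, Nat.succ_div]
  by_cases h : 2 ^ q ∣ k + 1 <;>
    rcases Nat.mod_two_eq_zero_or_one (k / 2 ^ q) with hmod | hmod <;>
    simp [h, hmod, Nat.add_mod]

theorem advances_increment (i : Track) :
    Advances (increment i) (ready n s w x a) (ready n s w (Function.update x i (x i + 1)) a)
      (decide (2 ^ n ∣ x i + 1)) := by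
  intro o v
  refine wp_block_cons <| wp_load <| wp_block_cons <| wp_mono (wp_sweep (b := .cells) (n := n)
    (x := fun q i => (x i).testBit q)
    (y := fun q j => (Function.update x i (x i + 1) j).testBit q)
    (st := fun _ => { ready n s w x a with out := o })
    (J := fun q v => v.carry = decide (2 ^ q ∣ x i + 1)) ?_ (fun _ _ _ h => h) ?_)
    fun _ _ h => wp_block_nil h
  · simp
  intro q _ v c r (hv : v.carry = _) (hcell : v.cell = _)
  refine wp_load ⟨?_, ?_, rfl⟩
  · simp [hv, hcell, two_pow_succ_dvd_succ_iff]
  · funext j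
    rcases eq_or_ne j i with rfl | hj
    · simp [Reg.sym, hv, hcell, testBit_succ_eq_xor]
    · simp [Reg.sym, hcell, hj]

theorem advances_firstLetter :
    Advances firstLetter (ready n s w x s) (ready n s w x 0) (decide (s = 0)) := by
  intro o v
  refine wp_block_cons <| wp_load <| wp_block_cons <| wp_mono (wp_sweep (b := .letters) (n := s)
    (x := fun b => compare b s) (y := fun b => compare b 0)
    (st := fun _ => { ready n s w x s with out := o })
    (J := fun b v => v.carry = decide (b = 0)) ?_ (fun _ _ _ h => h) ?_)
    fun _ _ h => wp_block_nil h
  · simp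
  intro b _ v c r (hv : v.carry = _) _
  refine wp_load ⟨by simp, ?_, rfl⟩
  rcases Nat.eq_zero_or_pos b with rfl | hb
  · simp [Reg.sym, hv]
  · simp [Reg.sym, hv, hb.ne', compare_gt_iff_gt.2 hb]

theorem advances_nextLetter (ha : a < s) :
    Advances nextLetter (ready n s w x a) (ready n s w x (a + 1)) (decide (a + 1 = s)) := by
  intro o v
  refine wp_block_cons <| wp_load <| wp_block_cons <| wp_mono (wp_sweep (b := .letters) (n := s)
    (x := fun b => compare b a) (y := fun b => compare b (a + 1))
    (st := fun _ => { ready n s w x a with out := o })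
    (J := fun b v => v.carry = decide (a + 1 = b)) ?_ (fun _ _ _ h => h) ?_)
    fun _ _ h => wp_block_nil h
  · simp
  intro b _ v c r (hv : v.carry = _) (hord : v.ord = _)
  refine wp_load ⟨by simp [hord, eq_comm (a := a)], ?_, rfl⟩
  change (if v.carry then Ordering.eq else if v.ord = .eq then .lt else v.ord) = _
  rw [hv, hord]
  rcases lt_trichotomy b a with h | rfl | h
  · rw [Nat.compare_eq_lt.2 h, Nat.compare_eq_lt.2 (h.trans a.lt_succ_self)]
    simp [(h.trans a.lt_succ_self).ne']
  · simp [Nat.compare_eq_lt.2 b.lt_succ_self]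
  · rcases eq_or_lt_of_le (Nat.succ_le_of_lt h) with rfl | h'
    · simp
    · rw [Nat.compare_eq_gt.2 h, Nat.compare_eq_gt.2 h']
      simp [Nat.ne_of_lt h']

theorem emits_forSubsets {i : Track} (hx : x i = 0)
    (h : ∀ k < 2 ^ n, Emits p (ready n s w (Function.update x i k) a) (g k)) :
    Emits (forSubsets i p) (ready n s w x a) ((List.range (2 ^ n)).flatMap g) := by
  refine emits_forLoop (st := fun k => ready n s w (Function.update x i k) a) ?_ h ?_ ?_
  · intro o v
    refine wp_load ⟨by simp, ?_⟩
    rw [← hx, Function.update_eq_self]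
  · intro k hk
    have hdvd : 2 ^ n ∣ k + 1 ↔ k + 1 = 2 ^ n :=
      ⟨fun h => le_antisymm hk (Nat.le_of_dvd k.succ_pos h), fun h => h ▸ dvd_rfl⟩
    simpa [hdvd] using advances_increment (n := n) (s := s) (w := w) (a := a)
      (x := Function.update x i k) i
  · have hcells : ∀ q ∈ List.range n, (fun j => (Function.update x i (2 ^ n) j).testBit q) =
        fun j => (x j).testBit q := by
      intro q hq
      funext j
      rcases eq_or_ne j i with rfl | hj
      · simp [hx, (List.mem_range.1 hq).ne']
      · simp [hj]
    simp only [ready, List.map_congr_left hcells]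

theorem emits_forLetters (h : ∀ a < s, Emits p (ready n s w x a) (g a)) :
    Emits (forLetters p) (ready n s w x s) ((List.range s).flatMap g) :=
  emits_forLoop (st := ready n s w x) advances_firstLetter h
    (fun _ ha => advances_nextLetter ha) rfl

end Loops

/-! ### Checking the transition conditions -/

/-- Take a value off its stack. -/
def popVal (f : Reg → Bool → Reg) : P :=
  .ite (.pop .vals f) (.push .spare fun _ => ()) (block [])

/-- Set `flag` to false unless each formula for the current state and the current letter is true, or
the current state is not on track `k`. -/
def checkRow (k : Track) (b : Bool) : P :=
  sweep .letters <| block [popVal fun v z => { v with bit := z },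
    popVal fun v z => { v with carry := z },
    .load fun v => { v with flag :=
      v.flag && (decide (v.ord ≠ .eq) || (!v.cell k || if b then v.bit else v.carry)) }]

/-- Compute the values of the formulae for tracks `i` and `j`, and set `flag` to whether those for
the current letter and the states on track `k` are true; `b` selects the formulae for configurations
whose datum is the current one. -/
def check (i j k : Track) (b : Bool) : P :=
  block [computeVals i j, .load fun v => { v with flag := true },
    sweep .cells (checkRow k b)]

/-- Run `p` provided that the formulae are true. -/
def ifAllSat (i j k : Track) (b : Bool) (p : P) : P :=
  block [check i j k b, .ite (.test (·.flag)) p (block [])]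

/-- The values in a table with `n` states and `s` letters. -/
def valueList (n s : ℕ) (V : ℕ → ℕ → Bool → Bool) : List Bool :=
  (List.range n).flatMap fun q => (List.range s).flatMap fun a => [V q a true, V q a false]

/-- `w` is a table of formulae such that the one for `q`, `a` and `b` has the value `V c c' q a b`
if states are interpreted by the bits of `c` without `↓` and by those of `c'` with `↓`. -/
def Tabulates (n s : ℕ) (w : List Token) (V : ℕ → ℕ → ℕ → ℕ → Bool → Bool) : Prop :=
  ∀ (x : Track → ℕ) (i j : Track),
    w.foldr (evalStep ((List.range n).map fun q i => (x i).testBit q) i j) (0, []) =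
      (0, valueList n s (V (x i) (x j)))

/-- All the formulae for letter `a` and the states in `d` are true. -/
def allSat (n : ℕ) (V : ℕ → ℕ → ℕ → ℕ → Bool → Bool) (c c' d a : ℕ) (b : Bool) : Bool :=
  (List.range n).all fun q => !d.testBit q || V c c' q a b

section Check

variable {n s : ℕ} {w : List Token} {x : Track → ℕ} {a : ℕ}
  {V : ℕ → ℕ → ℕ → ℕ → Bool → Bool}

theorem wp_popVal {Q : Reg → Tapes → Prop} {v : Reg} {t : Tapes} {N : ℕ} {l : List Bool}
    {f : Reg → Bool → Reg} {z : Bool} (hl : l.length < N) (h : Q (f v z) (t.withVals N l)) :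
    wp (popVal f) Q v (t.withVals N (z :: l)) := by
  refine wp_ite_some (eval_pop_of_cons rfl) (wp_push ?_)
  have hN : List.replicate (N - l.length) () = () :: List.replicate (N - (l.length + 1)) () := by
    rw [← List.replicate_succ, show N - (l.length + 1) + 1 = N - l.length by omega]
  rw [Tapes.withVals, hN] at h
  exact h

theorem drop_range_flatMap {m i : ℕ} (hi : i < m) {α : Type} (f : ℕ → List α) :
    ((List.range m).drop i).flatMap f = f i ++ ((List.range m).drop (i + 1)).flatMap f := by
  rw [List.drop_eq_getElem_cons (by simpa using hi), List.flatMap_cons, List.getElem_range]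

theorem length_valueList_le (hw : Tabulates n s w V) (x : Track → ℕ) (i j : Track) :
    (valueList n s (V (x i) (x j))).length ≤ w.length := by
  have h := length_foldl_evalStep_le (cs := (List.range n).map fun q i => (x i).testBit q)
    (i := i) (j := j) w.reverse
  rwa [List.foldl_reverse, hw x i j, List.length_reverse] at h

theorem wp_checkRow {v : Reg} {t : Tapes} {N : ℕ} {k : Track} {b : Bool} {U : ℕ → Bool → Bool}
    {r : List Bool} (ha : a < s)
    (hN : ((List.range s).flatMap fun a => [U a true, U a false]).length + r.length ≤ N) :
    wp (checkRow k b)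
      (fun v' t' => (v'.cell = v.cell ∧ v'.flag = (v.flag && (!v.cell k || U a b))) ∧
        t' = (t.withVals N r).withBand .letters ((List.range s).map fun b => compare b a) [])
      v ((t.withVals N (((List.range s).flatMap fun a => [U a true, U a false]) ++ r)).withBand
        .letters ((List.range s).map fun b => compare b a) []) := by
  refine wp_mono (wp_sweep (b := .letters) (n := s)
    (x := fun b => compare b a) (y := fun b => compare b a)
    (st := fun i => t.withVals N
      (((List.range s).drop i).flatMap (fun a => [U a true, U a false]) ++ r))
    (J := fun i v' => v'.cell = v.cell ∧
      v'.flag = (v.flag && (!decide (a < i) || (!v.cell k || U a b))))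
    ?_ (fun _ _ _ h => h) ?_) ?_
  · simp
  · rintro i hi v' c r' ⟨hcell, hflag⟩ (hord : v'.ord = _)
    have hlen := ((List.drop_sublist i (List.range s)).flatMap
      fun a => [U a true, U a false]).length_le
    rw [drop_range_flatMap hi] at hlen ⊢
    simp only [List.cons_append, List.nil_append, List.length_cons] at hlen ⊢
    refine wp_block_cons <| wp_popVal (t := t.withBand .letters c r') ?_ <| wp_block_cons <|
      wp_popVal (t := t.withBand .letters c r') ?_ <| wp_block_cons <| wp_load <|
      wp_block_nil ⟨⟨hcell, ?_⟩, hord, rfl⟩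
    · rw [List.length_cons, List.length_append]
      omega
    · rw [List.length_append]
      omega
    · rcases lt_trichotomy i a with h | rfl | h
      · simp [hflag, hord, Nat.compare_eq_lt.2 h, h.not_gt, h]
      · cases b <;> simp [hflag, hord, hcell]
      · simp [hflag, hord, Nat.compare_eq_gt.2 h, h, h.trans]
  · rintro v' _ ⟨⟨hcell, hflag⟩, rfl⟩
    rw [List.drop_of_length_le (List.length_range.le)]
    exact ⟨⟨hcell, by simpa [ha] using hflag⟩, rfl⟩

theorem wp_check (hw : Tabulates n s w V) (ha : a < s) (i j k : Track) (b : Bool)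
    (o : List Token) (v : Reg) :
    wp (check i j k b) (fun v' t' => v'.flag = allSat n V (x i) (x j) (x k) a b ∧
      t' = { ready n s w x a with out := o }) v { ready n s w x a with out := o } := by
  set t : Tapes := { ready n s w x a with out := o }
  set row : ℕ → List Bool := fun q => (List.range s).flatMap fun a =>
    [V (x i) (x j) q a true, V (x i) (x j) q a false]
  refine wp_block_cons (wp_mono (wp_computeVals (t := t) (N := w.length)
    (cs := (List.range n).map fun q i => (x i).testBit q) (u := w.reverse)
    (List.length_reverse.le)) ?_)
  rintro v _ rfl
  rw [List.foldl_reverse, hw x i j]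
  refine wp_block_cons <| wp_load <| wp_block_cons <| wp_mono (wp_sweep (b := .cells) (n := n)
    (x := fun q i => (x i).testBit q) (y := fun q i => (x i).testBit q)
    (st := fun q => t.withVals w.length (((List.range n).drop q).flatMap row))
    (J := fun q v => v.flag = (List.range q).all fun q =>
      !(x k).testBit q || V (x i) (x j) q a b) rfl (fun _ _ _ h => h) ?_) ?_
  · intro q hq v c r hflag (hcell : v.cell = _)
    have hlen := (((List.drop_sublist q (List.range n)).flatMap row).length_le).trans
      (length_valueList_le hw x i j)
    rw [drop_range_flatMap hq] at hlen ⊢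
    refine wp_mono (wp_checkRow (t := t.withBand .cells c r)
      (U := fun a b => V (x i) (x j) q a b) ha (by rwa [List.length_append] at hlen)) ?_
    rintro v' _ ⟨⟨hcell', hflag'⟩, rfl⟩
    refine ⟨?_, hcell'.trans hcell, rfl⟩
    simp [hflag', hflag, hcell, List.range_succ]
  · rintro v' _ ⟨hflag, rfl⟩
    rw [List.drop_of_length_le (List.length_range.le)]
    exact wp_block_nil ⟨hflag, rfl⟩

theorem emits_ifAllSat (hw : Tabulates n s w V) (ha : a < s) {i j k : Track} {b : Bool} {p : P}
    {u : List Token} (h : Emits p (ready n s w x a) u) :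
    Emits (ifAllSat i j k b p) (ready n s w x a)
      (if allSat n V (x i) (x j) (x k) a b then u else []) := by
  intro o v
  refine wp_block_cons (wp_mono (wp_check hw ha i j k b o v) ?_)
  rintro v' _ ⟨hflag, rfl⟩
  split_ifs with hsat
  · exact wp_block_cons <| wp_ite_some (eval_test_of_true (hflag.trans hsat)) <|
      h.wp fun v' => wp_block_nil rfl
  · exact wp_block_cons <| wp_ite_none
      (eval_test_of_false (hflag.trans (Bool.eq_false_iff.2 hsat))) <|
      wp_block_nil <| wp_block_nil rfl

end Check

/-! ### Writing the counter automaton -/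

/-- The bits of the set of states `k`, preceded by `y`. -/
def vec (n : ℕ) (y : Token) (k : ℕ) : List Token :=
  y :: ((List.range n).map fun q => bitTok (k.testBit q)) ++ [.sep]

/-- The description of the transfer for letter `a` when the states after the round are `e`. -/
def transferWord (n : ℕ) (V : ℕ → ℕ → ℕ → ℕ → Bool → Bool) (a e : ℕ) : List Token :=
  .transf :: .lpar :: ((List.range (2 ^ n)).flatMap fun d => (List.range (2 ^ n)).flatMap fun d' =>
    if allSat n V d' e d a false then vec n .one d ++ vec n .one d' else []) ++ [.rpar]

/-- The description of the transition reading letter `a` with states `c` before the round and `e`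
after it. -/
def readWord (n : ℕ) (V : ℕ → ℕ → ℕ → ℕ → Bool → Bool) (a c e : ℕ) : List Token :=
  vec n .zero c ++ .letter :: Token.tally a ++ transferWord n V a e ++ vec n .one e

/-- The descriptions of the transitions reading letters. -/
def readsWord (n s : ℕ) (V : ℕ → ℕ → ℕ → ℕ → Bool → Bool) : List Token :=
  (List.range (2 ^ n)).flatMap fun e => (List.range (2 ^ n)).flatMap fun c =>
    (List.range s).flatMap fun a => if allSat n V e e c a true then readWord n V a c e else []

/-- The descriptions of the two `ε` transitions for the set of states `c`. -/
def epsWord (n c : ℕ) : List Token :=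
  vec n .one c ++ .eps :: .inc :: vec n .one c ++ [.sep] ++
    (.sep :: .eps :: .dec :: vec n .one c ++ vec n .zero c)

/-- The list of transitions. -/
def transitionsWord (n s : ℕ) (V : ℕ → ℕ → ℕ → ℕ → Bool → Bool) : List Token :=
  .lpar :: ((List.range (2 ^ n)).flatMap (epsWord n) ++ readsWord n s V) ++ [.rpar]

/-- The list of states. -/
def statesWord (n : ℕ) : List Token :=
  .lpar :: (.sep :: (List.range (2 ^ n)).flatMap fun c => vec n .zero c ++ vec n .one c) ++ [.rpar]

/-- The list of counters. -/
def countersWord (n : ℕ) : List Token :=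
  .lpar :: (List.range (2 ^ n)).flatMap (vec n .one) ++ [.rpar]

/-- The description of the counter automaton, apart from the number of letters, where `c` is the
singleton of the initial state. -/
def bodyWord (n s : ℕ) (V : ℕ → ℕ → ℕ → ℕ → Bool → Bool) (c : ℕ) : List Token :=
  statesWord n ++ vec n .zero c ++ Token.tally (n + 1) ++ countersWord n ++ transitionsWord n s V

/-- Write a set of states with a preceding symbol. -/
def writeSet (y : Token) (i : Track) : P := block [emit y, emitTrack i, emit .sep]

/-- Write the transfer for the current letter and track `after`. -/
def writeTransfer : P :=
  block [emit .transf, emit .lpar,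
    forSubsets .source <| forSubsets .target <| ifAllSat .target .after .source false <|
      block [writeSet .one .source, writeSet .one .target],
    emit .rpar]

/-- Write the transitions reading letters. -/
def writeReads : P :=
  forSubsets .after <| forSubsets .listed <| forLetters <| ifAllSat .after .after .listed true <|
    block [writeSet .zero .listed, emit .letter, emitLetter, emit .sep, writeTransfer,
      writeSet .one .after]

/-- Write the `ε` transitions. -/
def writeEps : P :=
  forSubsets .listed <| block [writeSet .one .listed, emit .eps, emit .inc, writeSet .one .listed,
    emit .sep, emit .sep, emit .eps, emit .dec, writeSet .one .listed, writeSet .zero .listed]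

/-- Write the counter automaton, apart from the number of letters. -/
def writeBody : P :=
  block [emit .lpar, emit .sep,
    forSubsets .listed (block [writeSet .zero .listed, writeSet .one .listed]), emit .rpar,
    writeSet .zero .init, emitStateCount, emit .one, emit .sep,
    emit .lpar, forSubsets .listed (writeSet .one .listed), emit .rpar,
    emit .lpar, writeEps, writeReads, emit .rpar]

section Writing

variable {n s : ℕ} {w : List Token} {x : Track → ℕ} {a : ℕ}
  {V : ℕ → ℕ → ℕ → ℕ → Bool → Bool}

theorem emits_emitTrack (i : Track) :
    Emits (emitTrack i) (ready n s w x a)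
      ((List.range n).map fun q => bitTok ((x i).testBit q)) := by
  rw [List.map_eq_flatMap]
  refine emits_sweep (b := .cells) (t := ready n s w x a)
    (x := fun q i => (x i).testBit q) fun q _ v t hv => wp_push ⟨hv, ?_⟩
  rw [show v.cell = _ from hv]
  rfl

theorem emits_emitStateCount :
    Emits emitStateCount (ready n s w x a) (List.replicate n .one) := by
  have hn : List.replicate n Token.one = (List.range n).flatMap fun _ => [.one] := by
    simp [← List.map_eq_flatMap]
  rw [hn]
  exact emits_sweep (b := .cells) (t := ready n s w x a) (x := fun q i => (x i).testBit q)
    fun q _ v t hv => wp_push ⟨hv, rfl⟩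

theorem replicate_one_eq_flatMap (ha : a ≤ s) : List.replicate a Token.one =
    (List.range s).flatMap fun b => if compare b a = .lt then [.one] else [] := by
  obtain ⟨k, rfl⟩ := Nat.exists_eq_add_of_le ha
  have hlt : ((List.range a).flatMap fun b => if compare b a = .lt then [Token.one] else []) =
      (List.range a).flatMap fun _ => [Token.one] :=
    List.flatMap_congr fun b hb => if_pos (Nat.compare_eq_lt.2 (List.mem_range.1 hb))
  rw [List.range_add, List.flatMap_append, hlt]
  simp [← List.map_eq_flatMap, List.flatMap_map, Nat.compare_eq_lt]

theorem emits_emitLetter (ha : a ≤ s) :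
    Emits emitLetter (ready n s w x a) (List.replicate a .one) := by
  rw [replicate_one_eq_flatMap ha]
  refine emits_sweep (b := .letters) (t := ready n s w x a) (x := fun b => compare b a)
    fun b _ v t (hv : v.ord = _) => ?_
  split_ifs with h
  · exact wp_ite_some (eval_test_of_true (by simp [hv, h])) (wp_push ⟨hv, rfl⟩)
  · exact wp_ite_none (eval_test_of_false (by simp [hv, h])) (wp_block_nil ⟨hv, rfl⟩)

theorem emits_writeSet (y : Token) (i : Track) :
    Emits (writeSet y i) (ready n s w x a) (vec n y (x i)) :=
  (emits_emit y).block_cons <| (emits_emitTrack i).block_cons <|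
    (emits_emit .sep).block_cons .block_nil

theorem emits_writeTransfer (hw : Tabulates n s w V) (ha : a < s) (hsource : x .source = 0)
    (htarget : x .target = 0) :
    Emits writeTransfer (ready n s w x a) (transferWord n V a (x .after)) := by
  refine (emits_emit .transf).block_cons <| (emits_emit .lpar).block_cons <|
    Emits.block_cons (emits_forSubsets hsource fun d _ =>
      emits_forSubsets (by simpa using htarget) fun d' _ => ?_) <|
    (emits_emit .rpar).block_cons .block_nil
  have h := emits_ifAllSat (i := .target) (j := .after) (k := .source) (b := false)
    (x := Function.update (Function.update x .source d) .target d') hw ha <|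
    (emits_writeSet .one .source).block_cons <| (emits_writeSet .one .target).block_cons .block_nil
  simpa using h

theorem emits_writeReads (hw : Tabulates n s w V) (hx : ∀ i, i ≠ .init → x i = 0) :
    Emits writeReads (ready n s w x s) (readsWord n s V) := by
  refine emits_forSubsets (hx _ (by decide)) fun e _ => emits_forSubsets ?_ fun c _ =>
    emits_forLetters fun a ha => ?_
  · simpa using hx _ (by decide)
  set y := Function.update (Function.update x .after e) .listed c
  have h := emits_ifAllSat (i := .after) (j := .after) (k := .listed) (b := true)
    (x := y) hw ha <|
    (emits_writeSet .zero .listed).block_cons <| (emits_emit .letter).block_cons <|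
    (emits_emitLetter ha.le).block_cons <| (emits_emit .sep).block_cons <|
    (emits_writeTransfer hw ha (by simp [y, hx]) (by simp [y, hx])).block_cons <|
    (emits_writeSet .one .after).block_cons .block_nil
  simpa [readWord, Token.tally, y] using h

theorem emits_writeEps (hx : x .listed = 0) :
    Emits writeEps (ready n s w x a) ((List.range (2 ^ n)).flatMap (epsWord n)) := by
  refine emits_forSubsets hx fun c _ => ?_
  have h (y : Token) := emits_writeSet (n := n) (s := s) (w := w) (a := a)
    (x := Function.update x .listed c) y .listed
  simpa [epsWord] using (h .one).block_cons <| (emits_emit .eps).block_cons <|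
    (emits_emit .inc).block_cons <| (h .one).block_cons <| (emits_emit .sep).block_cons <|
    (emits_emit .sep).block_cons <| (emits_emit .eps).block_cons <|
    (emits_emit .dec).block_cons <| (h .one).block_cons <| (h .zero).block_cons .block_nil

theorem emits_writeBody (hw : Tabulates n s w V) (hx : ∀ i, i ≠ .init → x i = 0) :
    Emits writeBody (ready n s w x s) (bodyWord n s V (x .init)) := by
  have hlisted : x .listed = 0 := hx _ (by decide)
  have hstates : Emits (forSubsets .listed (block [writeSet .zero .listed, writeSet .one .listed]))
      (ready n s w x s) ((List.range (2 ^ n)).flatMap fun c => vec n .zero c ++ vec n .one c) :=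
    emits_forSubsets hlisted fun c _ => by
      simpa using (emits_writeSet (n := n) (s := s) (w := w) (a := s)
        (x := Function.update x .listed c) .zero .listed).block_cons <|
          (emits_writeSet .one .listed).block_cons .block_nil
  have hcounters : Emits (forSubsets .listed (writeSet .one .listed)) (ready n s w x s)
      ((List.range (2 ^ n)).flatMap (vec n .one)) :=
    emits_forSubsets hlisted fun c _ => by
      simpa using emits_writeSet (n := n) (s := s) (w := w) (a := s)
        (x := Function.update x .listed c) .one .listed
  have h := (emits_emit .lpar).block_cons <| (emits_emit .sep).block_cons <|
    hstates.block_cons <| (emits_emit .rpar).block_cons <|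
    (emits_writeSet .zero .init).block_cons <| emits_emitStateCount.block_cons <|
    (emits_emit .one).block_cons <| (emits_emit .sep).block_cons <|
    (emits_emit .lpar).block_cons <| hcounters.block_cons <| (emits_emit .rpar).block_cons <|
    (emits_emit .lpar).block_cons <| (emits_writeEps hlisted).block_cons <|
    (emits_writeReads hw hx).block_cons <| (emits_emit .rpar).block_cons .block_nil
  simpa [writeBody, bodyWord, statesWord, countersWord, transitionsWord, Token.tally,
    List.replicate_succ'] using h

end Writing

/-! ### Reading the register automaton -/

/-- Read a number in tally notation, running `p` for each stroke. -/
def readTally (p : P) : P :=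
  block [.load fun v => { v with flag := true },
    .loop (.test (·.flag)) (.ite (.pop .inp fun v x => { v with tok := x, flag := x = .one })
      (.ite (.test (·.flag)) p (block [])) (.load fun v => { v with flag := false }))]

/-- Put the current cell on track `init`, and return to the first cell. -/
def markInit : P :=
  block [.ite (.pop (.front .cells) (·.setSym .cells))
    (.push (.front .cells) fun v => Function.update v.cell .init true) (block []), rewind .cells]

/-- Move the rest of the input to the table, providing space for as many values. -/
def readTable : P :=
  .loop (.pop .inp fun v x => { v with tok := x })
    (block [.push .table (·.tok), .push .spare fun _ => ()])

/-- Read the register automaton, and write the number of letters. -/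
def readAll : P :=
  block [readTally (block [emit .one, .push (.front .letters) fun _ => .lt]), emit .sep,
    readTally (.push (.front .cells) fun _ _ => false),
    readTally advance, markInit, readTable]

/-- Read the register automaton and write the counter automaton. -/
def program : P := .seq readAll writeBody

/-- The weights of symbols for which `program` never increases the total weight: each symbol of
the input is turned into at most two others. -/
def weights : Stack → ℕ
  | .inp => 2
  | .out => 0
  | _ => 1

theorem credit_program : ∃ b, program.credit weights .out 0 = some b := ⟨_, rfl⟩

theorem wp_readTally {p : P} {v : Reg} {n : ℕ} {r : List Token} {st : ℕ → Tapes}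
    (hp : ∀ j < n, ∀ r v, v.flag = true → wp p
      (fun v' t' => v'.flag = true ∧ t' = { st (j + 1) with inp := r }) v { st j with inp := r }) :
    wp (readTally p) (fun _ t' => t' = { st n with inp := r }) v
      { st 0 with inp := Token.tally n ++ r } := by
  refine wp_block_cons <| wp_load <| wp_block_cons <| wp_mono ?_ fun v t => wp_block_nil
  suffices H : ∀ m j, j + m = n → ∀ v : Reg, v.flag = true →
      wp (.loop (.test (·.flag)) (.ite (.pop .inp fun v x => { v with tok := x, flag := x = .one })
        (.ite (.test (·.flag)) p (block [])) (.load fun v => { v with flag := false })))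
        (fun _ t' => t' = { st n with inp := r }) v
        { st j with inp := List.replicate m .one ++ .sep :: r } by
    simpa [Token.tally] using H n 0 (Nat.zero_add n) { v with flag := true } rfl
  intro m
  induction m with
  | zero =>
    rintro j rfl v hv
    exact wp_loop_some (eval_test_of_true hv) <| wp_ite_some (eval_pop_of_cons rfl) <|
      wp_ite_none (eval_test_of_false rfl) <| wp_block_nil <|
      wp_loop_none (eval_test_of_false rfl) rfl
  | succ m ih =>
    intro j hj v hv
    refine wp_loop_some (eval_test_of_true hv) <| wp_ite_some (eval_pop_of_cons rfl) <|
      wp_ite_some (eval_test_of_true rfl) <| wp_mono (hp j (by omega) _ _ rfl) ?_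
    rintro v' _ ⟨hv', rfl⟩
    exact ih (j + 1) (by omega) v' hv'

theorem wp_readTable {t : Tapes} {v : Reg} {w : List Token} :
    wp readTable
      (fun _ t' => t' = { t with
        inp := [], table := w.reverse, spare := List.replicate w.length () }) v
      { t with inp := w, table := [], spare := [] } := by
  refine wp_mono (wp_drain (k := .inp) (l := w) (J := fun _ _ => True) (st := fun i => { t with
    table := (w.take i).reverse, spare := List.replicate i () }) trivial ?_) ?_
  · intro i hi v _
    refine wp_block_cons <| wp_push <| wp_block_cons <| wp_push <| wp_block_nil ⟨trivial, ?_⟩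
    rw [List.take_succ_eq_append_getElem hi, List.reverse_append, List.replicate_succ]
    rfl
  · rintro _ _ ⟨-, rfl⟩
    simp [Tapes.put]

/-- The sets of states on the tracks after reading. -/
def initTracks (q : ℕ) : Track → ℕ := Function.update (fun _ => 0) .init (2 ^ q)

theorem map_initTracks {n q : ℕ} (hq : q < n) :
    ((List.range n).map fun j i => (initTracks q i).testBit j) =
      List.replicate q (fun _ => false) ++
        Function.update (fun _ => false) .init true ::
          List.replicate (n - (q + 1)) (fun _ => false) := by
  have hbit (j : ℕ) : (fun i => (initTracks q i).testBit j) =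
      Function.update (fun _ => false) .init (decide (q = j)) := by
    funext i
    by_cases hi : i = .init
    · simp [hi, initTracks, Nat.testBit_two_pow]
    · simp [hi, initTracks]
  rw [List.map_congr_left fun j _ => hbit j]
  refine List.ext_getElem (by simp; omega) fun j _ _ => ?_
  rcases lt_trichotomy j q with h | rfl | h
  · simp [List.getElem_append_left, h, h.ne']
  · simp
  · obtain ⟨k, rfl⟩ := Nat.exists_eq_add_of_lt h
    simp [Nat.add_assoc]

theorem wp_markInit {t : Tapes} {v : Reg} {n q : ℕ} (hq : q < n) :
    wp markInit (fun _ t' => t' = { t with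
        cells := (List.range n).map fun j i => (initTracks q i).testBit j, cellsR := [] }) v
      { t with
        cells := List.replicate (n - q) fun _ => false
        cellsR := List.replicate q fun _ => false } := by
  have hn : n - q = n - (q + 1) + 1 := by omega
  rw [hn, map_initTracks hq]
  refine wp_block_cons <| wp_ite_some (eval_pop_of_cons rfl) <| wp_push <| wp_block_cons <|
    wp_rewind (b := .cells) (t := t) (r := List.replicate q fun _ => false)
      (c := Function.update (fun _ => false) Track.init true ::
        List.replicate (n - (q + 1)) fun _ => false) fun z => wp_block_nil ?_
  rw [List.reverse_replicate]
  rfl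

theorem wp_readAll {v : Reg} {n s q : ℕ} (hq : q < n) {w : List Token} :
    wp readAll
      (fun _ t' => t' = { ready n s w (initTracks q) s with out := (Token.tally s).reverse }) v
      { inp := Token.tally s ++ (Token.tally n ++ (Token.tally q ++ w)) } := by
  refine wp_block_cons <| wp_mono (wp_readTally (st := fun j =>
    { out := List.replicate j .one, letters := List.replicate j .lt }) ?_) ?_
  · intro j _ r v hv
    exact wp_block_cons <| wp_push <| wp_block_cons <| wp_push <| wp_block_nil ⟨hv, rfl⟩
  rintro v _ rfl
  refine wp_block_cons <| wp_push <| wp_block_cons <| wp_mono (wp_readTally (st := fun j =>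
    { out := .sep :: List.replicate s .one
      letters := List.replicate s .lt
      cells := List.replicate j fun _ => false }) ?_) ?_
  · intro j _ r v hv
    exact wp_push ⟨hv, rfl⟩
  rintro v _ rfl
  refine wp_block_cons <| wp_mono (wp_readTally (st := fun j =>
    { out := .sep :: List.replicate s .one
      letters := List.replicate s .lt
      cells := List.replicate (n - j) fun _ => false
      cellsR := List.replicate j fun _ => false }) ?_) ?_
  · intro j hj r v hv
    have hn : n - j = n - (j + 1) + 1 := by omega
    rw [hn]
    exact wp_ite_some (eval_pop_of_cons rfl) (wp_push ⟨hv, rfl⟩)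
  rintro v _ rfl
  refine wp_block_cons <| wp_mono (wp_markInit (t := {
    inp := w
    out := .sep :: List.replicate s .one
    letters := List.replicate s .lt }) hq) ?_
  rintro v _ rfl
  refine wp_block_cons <| wp_mono (wp_readTable (t := {
    out := .sep :: List.replicate s .one
    letters := List.replicate s .lt
    cells := (List.range n).map fun j i => (initTracks q i).testBit j })) ?_
  rintro v _ rfl
  have hletters : (List.range s).map (fun b => compare b s) = List.replicate s .lt :=
    List.eq_replicate_iff.2 ⟨by simp, fun o ho => by
      obtain ⟨b, hb, rfl⟩ := List.mem_map.1 ho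
      exact Nat.compare_eq_lt.2 (List.mem_range.1 hb)⟩
  refine wp_block_nil ?_
  simp [ready, Tapes.withVals, hletters, Token.tally]

theorem exec_program {n s q : ℕ} {w : List Token} {V : ℕ → ℕ → ℕ → ℕ → Bool → Bool} (hq : q < n)
    (hw : Tabulates n s w V) :
    ∃ v' S', Prog.Exec program default (Function.update (fun _ => []) Stack.inp
      (Token.tally s ++ (Token.tally n ++ (Token.tally q ++ w)))) v' S' ∧
      (S' Stack.out).reverse = Token.tally s ++ bodyWord n s V (2 ^ q) := by
  have key : wp program (fun _ t => t.out.reverse = Token.tally s ++ bodyWord n s V (2 ^ q))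
      default { inp := Token.tally s ++ (Token.tally n ++ (Token.tally q ++ w)) } := by
    refine wp_seq <| wp_mono (wp_readAll hq) ?_
    rintro v _ rfl
    refine (emits_writeBody hw fun i hi => ?_).wp fun _ => ?_
    · simp [initTracks, hi]
    · simp [initTracks]
  obtain ⟨v', t', hex, hout⟩ := key
  refine ⟨v', t'.get, ?_, hout⟩
  convert hex using 1
  funext k
  rcases k with _ | _ | _ | _ | _ | _ | (_ | _) | (_ | _) <;> rfl

end IPCANTWriter

/-! ### The description of the counter automaton -/

/-- `EnumeratedBy s R w`: the string `w` is an enumeration of all members of `s`, without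
parentheses. -/
def EnumeratedBy {α : Type} (s : Set α) (R : α → List Token → Prop) (w : List Token) : Prop :=
  ∃ L : List (α × List Token),
    (∀ a, a ∈ s ↔ ∃ p ∈ L, p.1 = a) ∧ (∀ p ∈ L, R p.1 p.2) ∧ w = (L.map Prod.snd).flatten

namespace EnumeratedBy

variable {α ι : Type} {s t : Set α} {R : α → List Token → Prop} {w w' : List Token}

theorem isListing (h : EnumeratedBy s R w) : IsListing s R (.lpar :: (w ++ [.rpar])) := by
  obtain ⟨L, hs, hR, rfl⟩ := h
  exact ⟨L, hs, hR, rfl⟩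

theorem empty : EnumeratedBy ∅ R [] := ⟨[], by simp, by simp, rfl⟩

theorem singleton {a : α} (h : R a w) : EnumeratedBy {a} R w :=
  ⟨[(a, w)], by simp [eq_comm], by simpa using h, by simp⟩

theorem append (h : EnumeratedBy s R w) (h' : EnumeratedBy t R w') :
    EnumeratedBy (s ∪ t) R (w ++ w') := by
  obtain ⟨L, hs, hR, rfl⟩ := h
  obtain ⟨L', hs', hR', rfl⟩ := h'
  refine ⟨L ++ L', fun a => ?_, fun p hp => ?_, by simp⟩
  · simp only [Set.mem_union, hs, hs', List.mem_append, or_and_right, exists_or]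
  · exact (List.mem_append.1 hp).elim (hR p) (hR' p)

theorem ite {b : Bool} {p : Prop} (hb : b = true ↔ p) (h : EnumeratedBy s R w) :
    EnumeratedBy {a | p ∧ a ∈ s} R (if b then w else []) := by
  obtain rfl : (b = true) = p := propext hb
  cases b with
  | false => simpa using empty
  | true => simpa using h

theorem flatMap {l : List ι} {s : ι → Set α} {g : ι → List Token}
    (h : ∀ i ∈ l, EnumeratedBy (s i) R (g i)) : EnumeratedBy (⋃ i ∈ l, s i) R (l.flatMap g) := by
  induction l with
  | nil => simpa using empty
  | cons i l ih =>
    have := (h i (by simp)).append (ih fun j hj => h j (by simp [hj]))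
    simpa [Set.iUnion_or, Set.iUnion_union_distrib] using this

theorem flatMap_range {N : ℕ} {s : ι → Set α} {g : ℕ → List Token} (e : ι ≃ Fin N)
    (h : ∀ i, EnumeratedBy (s i) R (g (e i))) :
    EnumeratedBy (⋃ i, s i) R ((List.range N).flatMap g) := by
  have hl := flatMap (l := List.finRange N) (s := fun k => s (e.symm k)) (g := fun k => g k)
    fun k _ => by simpa using h (e.symm k)
  rw [← List.map_coe_finRange_eq_range, List.flatMap_map, ← e.symm.surjective.iUnion_comp]
  simpa using hl

end EnumeratedBy

namespace SafetyARA

open IPCANTWriter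

section Description

variable {S : Type} (A : SafetyARA S) (eQ : A.Q ≃ Fin (Fintype.card A.Q))

/-- The numbering of the sets of states by their characteristic bits. -/
noncomputable def setEquiv : Finset A.Q ≃ Fin (2 ^ Fintype.card A.Q) where
  toFun c := ⟨Nat.ofBits fun i => decide (eQ.symm i ∈ c), Nat.ofBits_lt_two_pow _⟩
  invFun k := {q | (k : ℕ).testBit (eQ q)}
  left_inv c := by
    ext q
    simp
  right_inv k := by
    refine Fin.ext (Nat.eq_of_testBit_eq fun i => ?_)
    by_cases hi : i < Fintype.card A.Q
    · simp [hi]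
    · have hk : (k : ℕ) < 2 ^ i :=
        k.isLt.trans_le (Nat.pow_le_pow_right Nat.two_pos (not_lt.1 hi))
      simp [not_lt.1 hi, Nat.testBit_lt_two_pow hk]

variable {A}

@[simp]
theorem testBit_setEquiv (c : Finset A.Q) (i : Fin (Fintype.card A.Q)) :
    (A.setEquiv eQ c : ℕ).testBit i = decide (eQ.symm i ∈ c) := by
  simp [setEquiv]

theorem setEquiv_singleton (q : A.Q) : (A.setEquiv eQ {q} : ℕ) = 2 ^ (eQ q : ℕ) := by
  refine Nat.eq_of_testBit_eq fun i => ?_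
  rw [Nat.testBit_two_pow]
  by_cases hi : i < Fintype.card A.Q
  · obtain ⟨p, hp⟩ := eQ.surjective ⟨i, hi⟩
    obtain rfl : (eQ p : ℕ) = i := congrArg Fin.val hp
    simp [Fin.val_inj, eq_comm]
  · have hlt : (A.setEquiv eQ {q} : ℕ) < 2 ^ i :=
      (A.setEquiv eQ {q}).isLt.trans_le (Nat.pow_le_pow_right Nat.two_pos (not_lt.1 hi))
    rw [Nat.testBit_lt_two_pow hlt, eq_comm, decide_eq_false_iff_not]
    exact fun h => hi (h ▸ (eQ q).isLt)

variable (A)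

/-- The numbering of the basis, which starts with the element common to all counters. -/
def basisEquiv : Option A.Q ≃ Fin (Fintype.card (Option A.Q)) :=
  eQ.optionCongr.trans
    ((finSuccEquiv (Fintype.card A.Q)).symm.trans (finCongr Fintype.card_option.symm))

/-- The characteristic bits of a set of states. -/
noncomputable def setBits (c : Finset A.Q) : List Bool :=
  (List.range (Fintype.card A.Q)).map (A.setEquiv eQ c : ℕ).testBit

/-- The names of the states. -/
noncomputable def stateName : CounterState A.Q → List Bool
  | .base => []
  | .before c => false :: A.setBits eQ c
  | .after e => true :: A.setBits eQ e

variable {A}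

theorem setBits_injective : Function.Injective (A.setBits eQ) := by
  intro c c' h
  ext q
  have := List.map_inj_left.1 h (eQ q) (List.mem_range.2 (eQ q).isLt)
  simpa using this

theorem stateName_injective : Function.Injective (A.stateName eQ) := by
  rintro (_ | c | c) (_ | c' | c') h <;>
    simp_all [stateName, (setBits_injective eQ).eq_iff]

theorem bits_stateName_base : Token.bits (A.stateName eQ .base) = [.sep] := rfl

theorem bits_stateName_before (c : Finset A.Q) :
    Token.bits (A.stateName eQ (.before c)) = vec (Fintype.card A.Q) .zero (A.setEquiv eQ c) := by
  simp [Token.bits, stateName, setBits, vec, bitTok, Function.comp_def]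

theorem bits_stateName_after (e : Finset A.Q) :
    Token.bits (A.stateName eQ (.after e)) = vec (Fintype.card A.Q) .one (A.setEquiv eQ e) := by
  simp [Token.bits, stateName, setBits, vec, bitTok, Function.comp_def]

theorem map_basisEquiv_symm_finRange {β : Type} (f : Option A.Q → β) :
    (List.finRange _).map (fun i => f ((A.basisEquiv eQ).symm i)) =
      f none :: (List.finRange _).map fun q => f (some (eQ.symm q)) := by
  refine List.ext_getElem (by simp) fun i _ _ => ?_
  cases i <;> simp only [List.getElem_map, List.getElem_finRange, List.getElem_cons_zero,
    List.getElem_cons_succ] <;> rfl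

theorem encodeSubset_counterEquiv (c : Finset A.Q) :
    A.toIPCANT.encodeSubset (A.basisEquiv eQ) (A.counterEquiv c).1 =
      vec (Fintype.card A.Q) .one (A.setEquiv eQ c) := by
  unfold SafetyIPCANT.encodeSubset Token.bits
  rw [map_basisEquiv_symm_finRange eQ fun x => decide (x ∈ (A.counterEquiv c).1)]
  simp [vec, bitTok, counterEquiv, ← List.map_coe_finRange_eq_range, Function.comp_def]

theorem describedBy_states :
    EnumeratedBy (Set.univ : Set A.toIPCANT.Q) (fun q u => u = Token.bits (A.stateName eQ q))
      (.sep :: (List.range (2 ^ Fintype.card A.Q)).flatMap fun c =>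
        vec (Fintype.card A.Q) .zero c ++ vec (Fintype.card A.Q) .one c) := by
  have huniv : (Set.univ : Set (CounterState A.Q)) =
      {.base} ∪ ⋃ c : Finset A.Q, {.before c} ∪ {.after c} := by
    refine (Set.eq_univ_of_forall ?_).symm
    rintro (_ | c | c)
    · exact .inl rfl
    · exact .inr (Set.mem_iUnion.2 ⟨c, .inl rfl⟩)
    · exact .inr (Set.mem_iUnion.2 ⟨c, .inr rfl⟩)
  rw [huniv]
  exact .append (w := [.sep]) (.singleton rfl) <| .flatMap_range (A.setEquiv eQ) fun c =>
    .append (.singleton (bits_stateName_before eQ c).symm)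
      (.singleton (bits_stateName_after eQ c).symm)

theorem describedBy_counters :
    EnumeratedBy (A.toIPCANT.C : Set (Finset A.toIPCANT.X))
      (fun c u => u = A.toIPCANT.encodeSubset (A.basisEquiv eQ) c)
      ((List.range (2 ^ Fintype.card A.Q)).flatMap (vec (Fintype.card A.Q) .one)) := by
  have hC : (A.counters : Set (Finset (Option A.Q))) = ⋃ c, {(A.counterEquiv c).1} := by
    ext c
    refine ⟨fun hc => ?_, fun hc => ?_⟩
    · obtain ⟨d, hd⟩ := A.counterEquiv.surjective ⟨c, hc⟩
      exact Set.mem_iUnion.2 ⟨d, (congrArg Subtype.val hd).symm⟩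
    · obtain ⟨d, rfl⟩ := Set.mem_iUnion.1 hc
      exact (A.counterEquiv d).2
  rw [hC]
  exact .flatMap_range (A.setEquiv eQ) fun c => .singleton (encodeSubset_counterEquiv eQ c).symm

variable (A) [Fintype S] (eS : S ≃ Fin (Fintype.card S))

open scoped Classical in
/-- The value of the formula for state number `q` and letter number `a`, if states are interpreted
by the bits of `c` without `↓` and by those of `c'` with `↓`. -/
noncomputable def tableValue (c c' q a : ℕ) (b : Bool) : Bool :=
  decide (∀ p t, (eQ p : ℕ) = q → (eS t : ℕ) = a →
    (A.δ p t b).Sat {p | c.testBit (eQ p) = true} {p | c'.testBit (eQ p) = true})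

/-- The formulae of the transition table. -/
def tableFormulas : List (PosBool A.Q) :=
  (List.finRange (Fintype.card A.Q)).flatMap fun q =>
    (List.finRange (Fintype.card S)).flatMap fun a =>
      [A.δ (eQ.symm q) (eS.symm a) true, A.δ (eQ.symm q) (eS.symm a) false]

theorem encode_eq : A.encode eS eQ =
    Token.tally (Fintype.card S) ++ (Token.tally (Fintype.card A.Q) ++
      (Token.tally (eQ A.init) ++
        (A.tableFormulas eQ eS).flatMap (·.encode fun q => (eQ q : ℕ)))) := by
  simp [encode, tableFormulas, List.flatMap_assoc]

theorem tableValue_eq_true_iff {c c' : ℕ} {q : A.Q} {a : S} {b : Bool} :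
    A.tableValue eQ eS c c' (eQ q) (eS a) b = true ↔
      (A.δ q a b).Sat {p | c.testBit (eQ p) = true} {p | c'.testBit (eQ p) = true} := by
  simp only [tableValue, decide_eq_true_eq, Fin.val_inj, EmbeddingLike.apply_eq_iff_eq]
  exact ⟨fun h => h q a rfl rfl, by rintro h _ _ rfl rfl; exact h⟩

theorem valueList_tableValue (c c' : ℕ) :
    valueList (Fintype.card A.Q) (Fintype.card S) (A.tableValue eQ eS c c') =
      (A.tableFormulas eQ eS).map
        (·.eval (fun p => c.testBit (eQ p)) fun p => c'.testBit (eQ p)) := by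
  have hvalue (q a b) : A.tableValue eQ eS c c' (q : Fin _) (a : Fin _) b =
      (A.δ (eQ.symm q) (eS.symm a) b).eval (fun p => c.testBit (eQ p))
        fun p => c'.testBit (eQ p) := by
    rw [Bool.eq_iff_iff, PosBool.eval_iff, ← tableValue_eq_true_iff, Equiv.apply_symm_apply,
      Equiv.apply_symm_apply]
  simp [valueList, tableFormulas, ← List.map_coe_finRange_eq_range, List.flatMap_map,
    List.map_flatMap, hvalue]

theorem tabulates_tableFormulas :
    Tabulates (Fintype.card A.Q) (Fintype.card S)
      ((A.tableFormulas eQ eS).flatMap (·.encode fun q => (eQ q : ℕ))) (A.tableValue eQ eS) := by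
  intro x i j
  rw [foldr_evalStep_flatMap_encode (x := fun q i => (x i).testBit (eQ q)) fun q => by simp,
    valueList_tableValue]

theorem allSat_tableValue_iff {c c' d : Finset A.Q} {a : S} {b : Bool} :
    allSat (Fintype.card A.Q) (A.tableValue eQ eS) (A.setEquiv eQ c) (A.setEquiv eQ c')
      (A.setEquiv eQ d) (eS a) b = true ↔ ∀ q ∈ d, (A.δ q a b).Sat (c : Set A.Q) c' := by
  have hall (P : ℕ → Bool) :
      (List.range (Fintype.card A.Q)).all P = true ↔ ∀ q, P (eQ q) = true := by
    simp [← eQ.symm.forall_congr_right, Fin.forall_iff]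
  simp only [allSat, hall, Bool.or_eq_true, Bool.not_eq_true', tableValue_eq_true_iff,
    testBit_setEquiv, Equiv.symm_apply_apply, decide_eq_false_iff_not, decide_eq_true_eq,
    Finset.setOfPred_mem, imp_iff_not_or]

theorem describedBy_transfer (a : S) (e : Finset A.Q) :
    A.toIPCANT.InstrDescribedBy (A.basisEquiv eQ) (.transf (A.transfer a e))
      (transferWord (Fintype.card A.Q) (A.tableValue eQ eS) (eS a) (A.setEquiv eQ e)) := by
  have hpairs : {p : A.counters × A.counters | p.2 ∈ A.transfer a e p.1} =
      ⋃ d, ⋃ d', {p | A.Moves a e d d' ∧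
        p ∈ ({(A.counterEquiv d, A.counterEquiv d')} : Set _)} := by
    ext ⟨c, c'⟩
    simp only [Set.mem_ofPred_eq, mem_transfer, Set.mem_iUnion, Set.mem_singleton_iff,
      Prod.mk.injEq, ← Equiv.symm_apply_eq]
    exact ⟨fun h => ⟨_, _, h, rfl, rfl⟩, by rintro ⟨_, _, h, rfl, rfl⟩; exact h⟩
  refine ⟨_, rfl, EnumeratedBy.isListing ?_⟩
  rw [hpairs]
  exact .flatMap_range (A.setEquiv eQ) fun d => .flatMap_range (A.setEquiv eQ) fun d' =>
    .ite (A.allSat_tableValue_iff eQ eS) <| .singleton <| by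
      rw [encodeSubset_counterEquiv, encodeSubset_counterEquiv]

theorem describedBy_epsTransitions :
    EnumeratedBy
      (⋃ c, {(.after c, none, .inc (A.counterEquiv c), .base)} ∪
        {(.base, none, .dec (A.counterEquiv c), .before c)})
      (A.toIPCANT.TransDescribedBy eS (A.basisEquiv eQ) (A.stateName eQ))
      ((List.range (2 ^ Fintype.card A.Q)).flatMap (epsWord (Fintype.card A.Q))) := by
  refine .flatMap_range (A.setEquiv eQ) fun c =>
    .append (.singleton ⟨_, rfl, ?_⟩) (.singleton ⟨_, rfl, ?_⟩)
  · simp [encodeSubset_counterEquiv, bits_stateName_base, bits_stateName_after,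
      SafetyIPCANT.encodeLabel]
  · simp [encodeSubset_counterEquiv, bits_stateName_base, bits_stateName_before,
      SafetyIPCANT.encodeLabel]

theorem describedBy_reads :
    EnumeratedBy
      (⋃ e, ⋃ c, ⋃ a, {t | A.Reads a c e ∧
        t ∈ ({(.before c, some a, .transf (A.transfer a e), .after e)} : Set _)})
      (A.toIPCANT.TransDescribedBy eS (A.basisEquiv eQ) (A.stateName eQ))
      (readsWord (Fintype.card A.Q) (Fintype.card S) (A.tableValue eQ eS)) := by
  refine .flatMap_range (A.setEquiv eQ) fun e => .flatMap_range (A.setEquiv eQ) fun c =>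
    .flatMap_range eS fun a => .ite (A.allSat_tableValue_iff eQ eS) <|
      .singleton ⟨_, A.describedBy_transfer eQ eS a e, ?_⟩
  rw [bits_stateName_before, bits_stateName_after]
  rfl

theorem describedBy_transitions :
    EnumeratedBy A.toIPCANT.δ
      (A.toIPCANT.TransDescribedBy eS (A.basisEquiv eQ) (A.stateName eQ))
      ((List.range (2 ^ Fintype.card A.Q)).flatMap (epsWord (Fintype.card A.Q)) ++
        readsWord (Fintype.card A.Q) (Fintype.card S) (A.tableValue eQ eS)) := by
  convert (A.describedBy_epsTransitions eQ eS).append (A.describedBy_reads eQ eS) using 1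
  ext t
  simp only [Set.mem_union, Set.mem_iUnion, Set.mem_ofPred_eq, Set.mem_singleton_iff]
  constructor
  · rintro (e | c | ⟨a, c, e, h⟩)
    · exact .inl ⟨e, .inl rfl⟩
    · exact .inl ⟨c, .inr rfl⟩
    · exact .inr ⟨e, c, a, h, rfl⟩
  · rintro (⟨c, rfl | rfl⟩ | ⟨e, c, a, h, rfl⟩)
    · exact .inc _
    · exact .dec _
    · exact .read _ _ _ h

/-- The string representing the counter automaton that is written by `program`. -/
noncomputable def description : List Token :=
  Token.tally (Fintype.card S) ++
    bodyWord (Fintype.card A.Q) (Fintype.card S) (A.tableValue eQ eS) (2 ^ (eQ A.init : ℕ))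

theorem describedBy_description : A.toIPCANT.DescribedBy eS (A.description eQ eS) := by
  refine ⟨A.basisEquiv eQ, A.stateName eQ, _, _, _, stateName_injective eQ,
    (describedBy_states eQ).isListing, (describedBy_counters eQ).isListing,
    (A.describedBy_transitions eQ eS).isListing, ?_⟩
  have hcard : Fintype.card A.toIPCANT.X = Fintype.card A.Q + 1 := Fintype.card_option
  rw [bits_stateName_before, setEquiv_singleton, hcard]
  simp only [description, bodyWord, statesWord, countersWord, transitionsWord, List.append_assoc,
    List.cons_append]

end Description

end SafetyARA

namespace IPCANTWriter

/-- The transducer that executes `program`. -/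
noncomputable def transducer : Transducer Token Token :=
  program.transducer weights .inp .out (by decide) (Equiv.refl Token) (Equiv.refl Token)
    credit_program.choose_spec

theorem transducer_outputsInSpace {S : Type} [Fintype S] (A : SafetyARA S)
    (eS : S ≃ Fin (Fintype.card S)) (eQ : A.Q ≃ Fin (Fintype.card A.Q)) :
    transducer.OutputsInSpace (A.encode eS eQ) (A.description eQ eS)
      (2 * (A.encode eS eQ).length) := by
  obtain ⟨v, st, hexec, hout⟩ := exec_program (eQ A.init).isLt (A.tabulates_tableFormulas eQ eS)
  rw [← A.encode_eq eQ eS] at hexec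
  have h := Prog.transducer_outputsInSpace (w := weights) (inp := .inp) (out := .out)
    (hne := by decide) (eI := Equiv.refl Token) (eO := Equiv.refl Token)
    (hp := credit_program.choose_spec) (x := A.encode eS eQ) (y := A.description eQ eS)
    (fun k hk => by cases k <;> simp_all [weights]) (by simpa using hexec)
    (by simpa [SafetyARA.description] using hout)
  simpa [weights, transducer] using h

end IPCANTWriter

theorem mainTheorem4 :
    ∃ (T : Transducer Token Token) (p : Polynomial ℕ) (k : ℕ),
      ∀ (S : Type) [Fintype S] (A : SafetyARA S)
        (eS : S ≃ Fin (Fintype.card S)) (eQ : A.Q ≃ Fin (Fintype.card A.Q)),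
        ∃ (C : SafetyIPCANT S) (w : List Token),
          T.OutputsInSpace (A.encode eS eQ) w (p.eval (A.encode eS eQ).length) ∧
          C.DescribedBy eS w ∧
          Fintype.card C.X ≤ k * Fintype.card A.Q ∧
          C.language = DataWord.str '' A.language ∧
          (C.language.Nonempty ↔ A.language.Nonempty) := by
  refine ⟨IPCANTWriter.transducer, 2 * Polynomial.X, 2, fun S _ A eS eQ =>
    ⟨A.toIPCANT, A.description eQ eS, ?_, A.describedBy_description eQ eS, ?_,
      A.toIPCANT_language, ?_⟩⟩
  · simpa using IPCANTWriter.transducer_outputsInSpace A eS eQ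
  · have hX : Fintype.card A.toIPCANT.X = Fintype.card A.Q + 1 := Fintype.card_option
    have hQ : 0 < Fintype.card A.Q := Fintype.card_pos_iff.2 ⟨A.init⟩
    omega
  · rw [A.toIPCANT_language, Set.image_nonempty]
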